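/- **Theorem (Bessel zeta convolution).** For complex $\nu$ and $z$ let $$J_\nu(z)=\sum_{m\ge 0}\frac{(-1)^m}{m!\,\Gamma(m+\nu+1)}\Big(\frac z2\Big)^{2m+\nu},\qquad I_\nu(z)=\sum_{m\ge 0}\frac{1}{m!\,\Gamma(m+\nu+1)}\Big(\frac z2\Big)^{2m+\nu}$$ be the Bessel function and the modified Bessel function of the first kind (principal branches, $1/\Gamma=0$ at the poles of $\Gamma$), and let $j_\nu(z)=2^\nu\,\Gamma(\nu+1)\,J_\nu(z)/z^\nu$. Let $\nu>-1$ be real. The positive zeros of $J_\nu$ form an infinite strictly increasing sequence $0<j_{\nu,1}<j_{\nu,2}<\cdots$; put $$\zeta_{B,\nu}(s)=\sum_{n=1}^\infty \frac1{j_{\nu,n}^{2s}},$$ which converges absolutely for every integer $s\ge 1$. Then for all real $\alpha,\beta>0$ and all integers $N\ge 1$ the two series on the right below converge absolutely, and $$\sum_{k=1}^{N}(-1)^k\alpha^{N-k+1}\beta^k\,\zeta_{B,\nu}(k)\,\zeta_{B,\nu}(N+1-k)=\nu\left(\alpha^{N+1}+(-\beta)^{N+1}\right)\zeta_{B,\nu}(N+1)$$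 $$-\frac{\alpha^{N+1}}2\sqrt{\frac\beta\alpha}\,\sum_{q=1}^\infty\frac1{j_{\nu,q}^{2N+1}}\,\frac{I_{\nu-1}\big(\sqrt{\beta/\alpha}\,j_{\nu,q}\big)}{I_{\nu}\big(\sqrt{\beta/\alpha}\,j_{\nu,q}\big)}-\frac{(-\beta)^{N+1}}2\sqrt{\frac\alpha\beta}\,\sum_{q=1}^\infty\frac1{j_{\nu,q}^{2N+1}}\,\frac{I_{\nu-1}\big(\sqrt{\alpha/\beta}\,j_{\nu,q}\big)}{I_{\nu}\big(\sqrt{\alpha/\beta}\,j_{\nu,q}\big)}.$$ In particular, for all real $\alpha,\beta>0$ and integers $N\ge1$ (all series below converge absolutely; $\zeta$ is the Riemann zeta function): * **$\nu=\tfrac12$.** $j_{1/2,n}=n\pi$ for $n\ge 1$; $j_{1/2}(z)=\frac{\sin z}{z}$ for $z\ne0$; $\frac{I_{-1/2}(z)}{I_{1/2}(z)}=\coth z$ when $\sinh z\neq 0$; and $$\sum_{k=1}^{N}(-\beta)^k\alpha^{N+1-k}\zeta(2k)\zeta(2N+2-2k)=\frac{\alpha^{N+1}+(-\beta)^{N+1}}{2}\zeta(2N+2)$$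 $$-\frac{\alpha^{N+1}\pi}{2}\sum_{n=1}^\infty\frac{1}{n^{2N+1}}\sqrt{\frac\beta\alpha}\coth\Big(\pi n\sqrt{\frac\beta\alpha}\Big)-\frac{\pi(-\beta)^{N+1}}{2}\sum_{n=1}^\infty\frac1{n^{2N+1}}\sqrt{\frac\alpha\beta}\coth\Big(\pi n\sqrt{\frac\alpha\beta}\Big).$$ * **$\nu=\tfrac32$.** $j_{3/2,n}=z_n$, where $z_n$ is the $n$-th positive root of $\tan x=x$; $\frac{I_{1/2}(z)}{I_{3/2}(z)}=\frac{z}{z\coth z-1}$ when $\sinh z\ne0$ and $z\coth z\neq 1$; and $$\sum_{k=1}^{N}(-1)^{k-1}\alpha^{N-k+1}\beta^k\zeta_{B,3/2}(k)\zeta_{B,3/2}(N+1-k)=-\tfrac32\,\zeta_{B,3/2}(N+1)\left[\alpha^{N+1}+(-\beta)^{N+1}\right]$$ $$+\frac{\alpha^N\beta}2\sum_{n=1}^\infty\frac1{z_n^{2N}}\,\frac1{\sqrt{\beta/\alpha}\,z_n\coth(\sqrt{\beta/\alpha}\,z_n)-1}+\frac{(-1)^{N+1}\beta^N\alpha}2\sum_{n=1}^\infty\frac1{z_n^{2N}}\,\frac1{\sqrt{\alpha/\beta}\,z_n\coth(\sqrt{\alpha/\beta}\,z_n)-1}.$$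 * **$\nu=-\tfrac12$.** $J_{-1/2}(z)=\sqrt{\tfrac2\pi}\,\frac{\cos z}{\sqrt z}$ for $z\ne0$; $j_{-1/2,n}=\frac\pi2(2n-1)$ for $n\geq 1$; $\zeta_{B,-1/2}(k)=\frac{2^{2k}-1}{\pi^{2k}}\zeta(2k)$ for integers $k\ge1$; $\frac{I_{-3/2}(z)}{I_{-1/2}(z)}=\tanh z-\frac1z$ when $z\neq0$ and $\cosh z\ne0$; and $$\sum_{k=1}^{N}(-1)^k\alpha^{N-k+1}\beta^k(2^{2k}-1)\zeta(2k)\,(2^{2N+2-2k}-1)\zeta(2N+2-2k)$$ $$=-\frac{\alpha^{N+1}}2\,\pi\sqrt{\frac\beta\alpha}\sum_{q=1}^\infty\frac{2^{2N+1}}{(2q-1)^{2N+1}}\tanh\Big(\frac\pi2\sqrt{\frac\beta\alpha}(2q-1)\Big)-\frac{(-\beta)^{N+1}}2\,\pi\sqrt{\frac\alpha\beta}\sum_{q=1}^\infty\frac{2^{2N+1}}{(2q-1)^{2N+1}}\tanh\Big(\frac\pi2\sqrt{\frac\alpha\beta}(2q-1)\Big).$$ -/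

import Mathlib

open scoped Nat

noncomputable section

/-- The Bessel function of the first kind `J_ν(z)` (principal branch of `(z/2)^ν`). `Complex.Gamma`
vanishes at its poles and `1 / 0 = 0`, so `1 / Γ` is the entire function for every order `ν`. -/
def besselJ (ν z : ℂ) : ℂ :=
  ∑' m : ℕ, (-1) ^ m / ((m ! : ℂ) * Complex.Gamma (m + ν + 1)) * (z / 2) ^ (2 * (m : ℂ) + ν)

/-- The modified Bessel function of the first kind `I_ν(z)` (principal branch). -/
def besselI (ν z : ℂ) : ℂ :=
  ∑' m : ℕ, 1 / ((m ! : ℂ) * Complex.Gamma (m + ν + 1)) * (z / 2) ^ (2 * (m : ℂ) + ν)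

/-- The normalized Bessel function `j_ν(z) = 2^ν Γ(ν+1) J_ν(z) / z^ν`, for `z ≠ 0`. -/
def normalizedBesselJ (ν z : ℂ) : ℂ :=
  2 ^ ν * Complex.Gamma (ν + 1) * besselJ ν z / z ^ ν

/-- Increasing enumeration of the positive elements of a set of reals (with `nthPositive S 0 = 0`):
`nthPositive S n`, `n ≥ 1`, is the `n`-th positive element of `S`, provided that the positive
elements of `S` form an infinite set that has no accumulation point in `[0, ∞)`. -/
def nthPositive (S : Set ℝ) : ℕ → ℝ
  | 0 => 0
  | n + 1 => sInf {x : ℝ | nthPositive S n < x ∧ x ∈ S}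

/-- `j_{ν,n}`, the `n`-th positive zero of `J_ν`, for `n ≥ 1`. -/
def besselJZero (ν : ℝ) : ℕ → ℝ :=
  nthPositive {x : ℝ | besselJ ν x = 0}

/-- The Bessel zeta function `ζ_{B,ν}(s) = ∑_{n ≥ 1} 1 / j_{ν,n}^{2s}`. -/
def besselZeta (ν : ℝ) (s : ℂ) : ℂ :=
  ∑' n : ℕ, 1 / (besselJZero ν (n + 1) : ℂ) ^ (2 * s)

/-- `z_n`, the `n`-th positive root of `tan x = x`, for `n ≥ 1`. (`Real.tan` is `0` at its poles,
so these contribute no positive root.) -/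
def tanRoot : ℕ → ℝ :=
  nthPositive {x : ℝ | Real.tan x = x}

/-- The hyperbolic cotangent (for `sinh z ≠ 0`). -/
def cothC (z : ℂ) : ℂ := Complex.cosh z / Complex.sinh z

end

/-! Everything is carried by the entire function E_ν(w) = ∑ w^m / (m! Γ(m+ν+1)) (`besselE`): J_ν(z)
= (z/2)^ν E_ν(-z²/4) and I_ν(z) = (z/2)^ν E_ν(z²/4). It satisfies E_ν' = E_{ν+1} and E_ν = (ν+1)
E_{ν+1} + w E_{ν+2}, and it has minimal exponential type. For ν > -1 its zeros are simple, negative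
and infinite in number; they are the points -j_n²/4.

Minimal type with simple zeros forces E_{ν+1}/E_ν to be the sum of its simple poles, with no entire
remainder (`MinimalType.tendsto_sum_inv`, via Borel–Carathéodory). Together with the recurrence this
gives I_{ν-1}(x)/I_ν(x) = 2ν/x + ∑_n 2x/(x² + j_n²) for x > 0 (`exists_hasSum_besselI_div`). Put x =
r j_q with r² = β/α, divide by j_q^{2N+1} and sum over q: the result is a multiple of ζ_B(N+1) plus
a multiple of the double series D(α,β) = ∑_{p,n} 1 / (j_p^{2N} (β j_p² + α j_n²))
(`hasSum_weighted`).

The convolution of zeta values is also a double series. Its (p,n) term is the finite geometric sum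
∑_k A^{N+1-k} B^k with A = α/j_p², B = -β/j_n². Summing it as AB(A^N - B^N)/(A - B) leaves one
multiple of D(α,β) and one of D(β,α) (`sum_convolution`). Eliminating the two double series proves
the identity.

For ν = ±1/2 and 3/2, E_ν is elementary: the duplication formula gives E_{-1/2}(z²/4) = cosh z / √π,
and differentiation and the recurrence give the rest. -/

noncomputable section

open Filter Topology Metric

/-! ### Removing zeros from an entire function; logarithms of the quotient -/

/-- An entire function can be divided by the linear factors of finitely many of its zeros. -/
lemma exists_eq_prod_one_sub_div_mul {F : ℂ → ℂ} (hF : Differentiable ℂ F) (S : Finset ℂ)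
    (h0 : ∀ s ∈ S, s ≠ 0) (hS : ∀ s ∈ S, F s = 0) :
    ∃ g : ℂ → ℂ, Differentiable ℂ g ∧ ∀ w, F w = (∏ s ∈ S, (1 - w / s)) * g w := by
  classical
  induction S using Finset.induction_on with
  | empty => exact ⟨F, hF, by simp⟩
  | insert a S ha ih =>
    obtain ⟨g, hg, hFg⟩ := ih (fun s hs => h0 s (Finset.mem_insert_of_mem hs))
      (fun s hs => hS s (Finset.mem_insert_of_mem hs))
    have ha0 : a ≠ 0 := h0 a (Finset.mem_insert_self _ _)
    have hga : g a = 0 := by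
      have h1 := hFg a
      rw [hS a (Finset.mem_insert_self _ _)] at h1
      rcases mul_eq_zero.mp h1.symm with h2 | h2
      · obtain ⟨s, hs, h3⟩ := Finset.prod_eq_zero_iff.mp h2
        have hs0 := h0 s (Finset.mem_insert_of_mem hs)
        have : a = s := by
          field_simp at h3
          linear_combination -h3
        exact absurd (this ▸ hs) ha
      · exact h2
    -- The factor -a comes from w - a = -a (1 - w/a).
    refine ⟨fun w => -a * dslope g a w, ?_, fun w => ?_⟩
    · refine Differentiable.const_mul ?_ _
      rw [← differentiableOn_univ]
      exact (Complex.differentiableOn_dslope univ_mem).mpr hg.differentiableOn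
    · have h4 := sub_smul_dslope g a w
      rw [hga, sub_zero, smul_eq_mul] at h4
      rw [Finset.prod_insert ha, hFg w, ← h4]
      field_simp
      ring

/-- A zero-free holomorphic function on a disc about the origin has a holomorphic logarithm. -/
lemma exists_holomorphic_log {g : ℂ → ℂ} (hg : Differentiable ℂ g) {R : ℝ} (hR : 0 < R)
    (h0 : ∀ w ∈ ball (0 : ℂ) R, g w ≠ 0) :
    ∃ h : ℂ → ℂ, DifferentiableOn ℂ h (ball 0 R) ∧ h 0 = 0 ∧
      ∀ w ∈ ball (0 : ℂ) R, g w = g 0 * Complex.exp (h w) := by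
  have hd : DifferentiableOn ℂ (fun w => deriv g w / g w) (ball 0 R) :=
    (hg.deriv.differentiableOn).div hg.differentiableOn h0
  obtain ⟨h, hh⟩ := hd.isExactOn_ball
  have hder : ∀ w ∈ ball (0 : ℂ) R,
      HasDerivAt (fun z => g z * Complex.exp (-(h z - h 0))) 0 w := by
    intro w hw
    refine ((hg w).hasDerivAt.fun_mul (((hh w hw).sub_const (h 0)).fun_neg.cexp)).congr_deriv ?_
    have := h0 w hw
    have e : deriv g w = deriv g w / g w * g w := by field_simp
    linear_combination (Complex.exp (-(h w - h 0))) * e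
  refine ⟨fun w => h w - h 0, fun w hw =>
    ((hh w hw).sub_const _).differentiableAt.differentiableWithinAt, by simp, fun w hw => ?_⟩
  have hc := (convex_ball (0 : ℂ) R).is_const_of_fderivWithin_eq_zero (𝕜 := ℂ)
    (f := fun z => g z * Complex.exp (-(h z - h 0)))
    (fun z hz => (hder z hz).differentiableAt.differentiableWithinAt)
    (fun z hz => by
      rw [fderivWithin_of_isOpen isOpen_ball hz]
      have := (hder z hz).hasFDerivAt.fderiv
      rw [this]; ext; simp) hw (mem_ball_self hR)
  simp only [sub_self, neg_zero, Complex.exp_zero, mul_one] at hc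
  rw [← hc, mul_assoc, ← Complex.exp_add]
  simp

/-- Factorization of an entire function on a disc, with a bound for the logarithm of the
zero-free factor. -/
lemma exists_log_factor {F : ℂ → ℂ} (hF : Differentiable ℂ F) (hF0 : F 0 ≠ 0) {R M : ℝ}
    (hR : 0 < R) (hM : 0 < M) (hb : ∀ w : ℂ, ‖w‖ ≤ 2 * R → ‖F w‖ ≤ ‖F 0‖ * Real.exp M)
    (S : Finset ℂ) (hS : ∀ s, s ∈ S ↔ ‖s‖ < R ∧ F s = 0) (hd : ∀ s ∈ S, deriv F s ≠ 0) :
    ∃ h : ℂ → ℂ, DifferentiableOn ℂ h (ball 0 R) ∧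
      (∀ w ∈ ball (0 : ℂ) R, F w = F 0 * (∏ s ∈ S, (1 - w / s)) * Complex.exp (h w)) ∧
      ∀ w ∈ ball (0 : ℂ) R, ‖h w‖ ≤ 2 * M * ‖w‖ / (R - ‖w‖) := by
  have hS0 : ∀ s ∈ S, s ≠ 0 := by
    rintro s hs rfl
    exact hF0 ((hS 0).mp hs).2
  obtain ⟨g, hg, hFg⟩ := exists_eq_prod_one_sub_div_mul hF S hS0 (fun s hs => ((hS s).mp hs).2)
  have hg0 : g 0 = F 0 := by simp [hFg 0]
  have hgne : ∀ w ∈ ball (0 : ℂ) R, g w ≠ 0 := by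
    -- A zero of g in the disc would be a zero of F whose linear factor has already been removed,
    -- hence a double zero of F.
    intro w hw hgw
    have hFw : F w = 0 := by rw [hFg, hgw, mul_zero]
    have hwS : w ∈ S := (hS w).mpr ⟨by simpa using hw, hFw⟩
    have hP : Differentiable ℂ (fun w => ∏ s ∈ S, (1 - w / s)) := by fun_prop
    have h1 := (hP w).hasDerivAt.mul (hg w).hasDerivAt
    have h2 : (∏ s ∈ S, (1 - w / s)) = 0 :=
      Finset.prod_eq_zero hwS (by rw [div_self (hS0 w hwS), sub_self])
    have h3 : F = (fun w => ∏ s ∈ S, (1 - w / s)) * g := by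
      funext z; simp [hFg z]
    rw [← h3, hgw, h2] at h1
    exact hd w hwS (by simpa using h1.deriv)
  obtain ⟨h, hhd, hh0, hgh⟩ := exists_holomorphic_log hg hR hgne
  have hbound : ∀ w ∈ ball (0 : ℂ) R, ‖g w‖ ≤ ‖F 0‖ * Real.exp M := by
    intro w hw
    -- Maximum principle on the disc of radius 2R: on its boundary |z/s| ≥ 2, so every factor |1 -
    -- z/s| is at least 1 and |g| ≤ |F| there.
    refine Complex.norm_le_of_forall_mem_frontier_norm_le (U := ball 0 (2 * R)) isBounded_ball
      hg.diffContOnCl ?_ (subset_closure (ball_subset_ball (by linarith) hw))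
    intro z hz
    rw [frontier_ball _ (by positivity), mem_sphere_zero_iff_norm] at hz
    refine le_trans ?_ (hb z hz.le)
    rw [hFg z, norm_mul, norm_prod]
    refine le_mul_of_one_le_left (norm_nonneg _) ?_
    refine Finset.one_le_prod fun s hs => ?_
    have hs1 : ‖s‖ < R := ((hS s).mp hs).1
    have hs2 : 0 < ‖s‖ := norm_pos_iff.mpr (hS0 s hs)
    have h5 : 2 ≤ ‖z / s‖ := by
      rw [norm_div, hz, le_div_iff₀ hs2]; linarith
    have h6 := norm_sub_norm_le (z / s) 1
    rw [norm_one, norm_sub_rev] at h6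
    linarith
  refine ⟨h, hhd, fun w hw => ?_, fun w hw => ?_⟩
  · rw [hFg w, hgh w hw, hg0]; ring
  -- The bound on |g| says Re h ≤ M, which is what Borel–Carathéodory needs.
  · refine Complex.borelCaratheodory_zero hM hhd (fun z hz => ?_) hR hw hh0
    have h7 := hbound z hz
    rw [hgh z hz, hg0, norm_mul, Complex.norm_exp] at h7
    exact Real.exp_le_exp.mp (le_of_mul_le_mul_left h7 (norm_pos_iff.mpr hF0))

/-- The difference is h'(w) for the logarithm h of the zero-free factor. The Cauchy estimate on the
circle of radius R/4 about w, which stays in |z| ≤ R/2 where |h| ≤ 2M, bounds it by 2M/(R/4). -/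
lemma norm_logDeriv_sub_sum_le {F : ℂ → ℂ} (hF : Differentiable ℂ F) (hF0 : F 0 ≠ 0) {R M : ℝ}
    (hR : 0 < R) (hM : 0 < M) (hb : ∀ w : ℂ, ‖w‖ ≤ 2 * R → ‖F w‖ ≤ ‖F 0‖ * Real.exp M)
    (S : Finset ℂ) (hS : ∀ s, s ∈ S ↔ ‖s‖ < R ∧ F s = 0) (hd : ∀ s ∈ S, deriv F s ≠ 0)
    {w : ℂ} (hw : ‖w‖ ≤ R / 4) (hFw : F w ≠ 0) :
    ‖deriv F w / F w - ∑ s ∈ S, 1 / (w - s)‖ ≤ 8 * M / R := by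
  obtain ⟨h, hhd, hfac, hle⟩ := exists_log_factor hF hF0 hR hM hb S hS hd
  have hS0 : ∀ s ∈ S, s ≠ 0 := by
    rintro s hs rfl
    exact hF0 ((hS 0).mp hs).2
  have hwR : w ∈ ball (0 : ℂ) R := by simpa using (by linarith : ‖w‖ < R)
  have hws : ∀ s ∈ S, w - s ≠ 0 := by
    intro s hs h0
    rw [sub_eq_zero.mp h0] at hFw
    exact hFw ((hS s).mp hs).2
  have hlin : ∀ s ∈ S, (1 - w / s) ≠ 0 := by
    intro s hs h0
    have := hS0 s hs
    have := hws s hs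
    field_simp at h0
    exact this (by linear_combination -h0)
  have hdh : DifferentiableAt ℂ h w := hhd.differentiableAt (isOpen_ball.mem_nhds hwR)
  have hlog : deriv F w / F w = ∑ s ∈ S, 1 / (w - s) + deriv h w := by
    have heq : F =ᶠ[𝓝 w] fun w => F 0 * (∏ s ∈ S, (1 - w / s)) * Complex.exp (h w) :=
      Filter.eventually_of_mem (isOpen_ball.mem_nhds hwR) hfac
    have h1 : logDeriv F w = logDeriv (fun w => F 0 * (∏ s ∈ S, (1 - w / s)) * Complex.exp (h w)) w := by
      rw [logDeriv_apply, logDeriv_apply, heq.deriv_eq, heq.eq_of_nhds]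
    have hP : Differentiable ℂ (fun w => ∏ s ∈ S, (1 - w / s)) := by fun_prop
    rw [← logDeriv_apply, h1, logDeriv_mul (f := fun w => F 0 * ∏ s ∈ S, (1 - w / s)) (g := fun w => Complex.exp (h w)) w
      (mul_ne_zero hF0 (Finset.prod_ne_zero_iff.mpr hlin))
      (Complex.exp_ne_zero _) ((hP w).const_mul _) hdh.cexp, logDeriv_const_mul _ _ hF0,
      logDeriv_prod hlin (fun s _ => by fun_prop)]
    congr 1
    · refine Finset.sum_congr rfl fun s hs => ?_
      have h2 : HasDerivAt (fun w : ℂ => 1 - w / s) (-(1 / s)) w :=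
        ((hasDerivAt_id w).div_const s).const_sub 1
      rw [logDeriv_apply, h2.deriv]
      have := hS0 s hs
      have := hws s hs
      have := hlin s hs
      have e : 1 - w / s = -(w - s) / s := by field_simp; ring
      rw [e]; field_simp
    · rw [logDeriv_apply, hdh.hasDerivAt.cexp.deriv]
      field_simp [Complex.exp_ne_zero]
  rw [hlog, add_sub_cancel_left]
  have hsub : closedBall w (R / 4) ⊆ ball 0 R := by
    intro z hz
    have h3 : ‖z - w‖ ≤ R / 4 := by simpa [dist_eq_norm] using hz
    have h4 := norm_le_norm_add_norm_sub' z w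
    simpa using (by linarith : ‖z‖ < R)
  have h5 := Complex.norm_deriv_le_of_forall_mem_sphere_norm_le (f := h) (c := w) (R := R / 4)
    (C := 2 * M) (by positivity)
    (DifferentiableOn.diffContOnCl (by
      rw [closure_ball _ (by positivity)]; exact hhd.mono hsub))
    (fun z hz => by
      have hz' : ‖z - w‖ = R / 4 := by simpa [dist_eq_norm] using hz
      have h4 := norm_le_norm_add_norm_sub' z w
      have hzb : ‖z‖ ≤ R / 2 := by linarith
      refine (hle z (hsub (sphere_subset_closedBall hz))).trans ?_
      rw [div_le_iff₀ (by linarith)]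
      nlinarith)
  refine h5.trans (le_of_eq ?_)
  field_simp
  ring

/-! ### Entire functions of minimal exponential type -/

/-- Minimal exponential type. -/
def MinimalType (F : ℂ → ℂ) : Prop :=
  ∀ ε : ℝ, 0 < ε → ∃ C : ℝ, ∀ w : ℂ, ‖F w‖ ≤ C * Real.exp (ε * ‖w‖)

/-- The constant C of the type bound moves into the exponent as log(C/|F 0|), which is nonnegative
by the bound at w = 0; the added 1 makes K strictly positive. -/
lemma MinimalType.exists_bound {F : ℂ → ℂ} (hF : MinimalType F) (hF0 : F 0 ≠ 0) {ε : ℝ}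
    (hε : 0 < ε) : ∃ K : ℝ, 0 < K ∧ ∀ R : ℝ, 0 ≤ R → ∀ w : ℂ, ‖w‖ ≤ 2 * R →
      ‖F w‖ ≤ ‖F 0‖ * Real.exp (K + ε * R) := by
  obtain ⟨C, hC⟩ := hF (ε / 2) (by positivity)
  have hn : 0 < ‖F 0‖ := norm_pos_iff.mpr hF0
  have hC0 : ‖F 0‖ ≤ C := by simpa using hC 0
  have hC1 : 0 < C := hn.trans_le hC0
  refine ⟨Real.log (C / ‖F 0‖) + 1, ?_, fun R hR w hw => ?_⟩
  · have := Real.log_nonneg ((one_le_div hn).mpr hC0)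
    linarith
  · refine (hC w).trans ?_
    have h1 : C = ‖F 0‖ * Real.exp (Real.log (C / ‖F 0‖)) := by
      rw [Real.exp_log (by positivity)]; field_simp
    rw [h1, mul_assoc, ← Real.exp_add, ← h1]
    refine mul_le_mul_of_nonneg_left (Real.exp_le_exp.mpr ?_) hn.le
    nlinarith

/-- Partial fraction expansion of the logarithmic derivative of an entire function of minimal
type with simple zeros. -/
lemma MinimalType.tendsto_sum_inv {F : ℂ → ℂ} (hF : Differentiable ℂ F) (hF0 : F 0 ≠ 0)
    (hmin : MinimalType F) (hd : ∀ s, F s = 0 → deriv F s ≠ 0)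
    {R : ℕ → ℝ} (hR : Tendsto R atTop atTop) {S : ℕ → Finset ℂ}
    (hS : ∀ k s, s ∈ S k ↔ ‖s‖ < R k ∧ F s = 0) {w : ℂ} (hFw : F w ≠ 0) :
    Tendsto (fun k => ∑ s ∈ S k, 1 / (w - s)) atTop (𝓝 (deriv F w / F w)) := by
  rw [Metric.tendsto_atTop']
  intro ε hε
  -- With M = K + (ε/16) R the error 8M/R equals 8K/R + ε/2, which is below ε once R > 16K/ε.
  obtain ⟨K, hK, hKb⟩ := hmin.exists_bound hF0 (ε := ε / 16) (by positivity)
  obtain ⟨N, hN⟩ := (hR.eventually_gt_atTop (max (4 * ‖w‖) (16 * K / ε))).exists_forall_of_atTop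
  refine ⟨N, fun k hk => ?_⟩
  have h1 := hN k hk.le
  obtain ⟨h2, h3⟩ := max_lt_iff.mp h1
  have hRk : 0 < R k := lt_of_le_of_lt (by positivity) h2
  rw [dist_comm, dist_eq_norm]
  refine (norm_logDeriv_sub_sum_le hF hF0 hRk (M := K + ε / 16 * R k) (by positivity)
    (hKb (R k) hRk.le) (S k) (hS k) (fun s hs => hd s ((hS k s).mp hs).2) (by linarith) hFw).trans_lt ?_
  rw [div_lt_iff₀ hRk]
  rw [div_lt_iff₀ hε] at h3
  nlinarith

/-- An entire function of minimal type with finitely many zeros, all simple, is a polynomial. -/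
lemma MinimalType.eq_prod {F : ℂ → ℂ} (hF : Differentiable ℂ F) (hF0 : F 0 ≠ 0)
    (hmin : MinimalType F) (hd : ∀ s, F s = 0 → deriv F s ≠ 0) (S : Finset ℂ)
    (hS : ∀ s, s ∈ S ↔ F s = 0) (w : ℂ) : F w = F 0 * ∏ s ∈ S, (1 - w / s) := by
  obtain ⟨B, hB⟩ : ∃ B : ℝ, ∀ s ∈ S, ‖s‖ < B := by
    refine ⟨∑ s ∈ S, ‖s‖ + 1, fun s hs => ?_⟩
    have := Finset.single_le_sum (f := fun s : ℂ => ‖s‖) (fun _ _ => norm_nonneg _) hs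
    linarith
  -- S holds all the zeros, so the radius can grow while the product stays fixed, and the logarithm
  -- h(w) becomes arbitrarily small.
  have key : ∀ ε : ℝ, 0 < ε → ∃ v : ℂ, ‖v‖ < ε ∧
      F w = F 0 * (∏ s ∈ S, (1 - w / s)) * Complex.exp v := by
    intro ε hε
    -- Once K ≤ δR and |w| ≤ R/2, Borel–Carathéodory gives |h(w)| ≤ 8δ|w| < ε.
    set δ := ε / (8 * (‖w‖ + 1)) with hδ
    have hδ0 : 0 < δ := by positivity
    obtain ⟨K, hK, hKb⟩ := hmin.exists_bound hF0 hδ0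
    set R := max (max B (2 * ‖w‖ + 1)) (K / δ) with hRdef
    have hR1 : B ≤ R := (le_max_left _ _).trans (le_max_left _ _)
    have hR2 : 2 * ‖w‖ + 1 ≤ R := (le_max_right _ _).trans (le_max_left _ _)
    have hR3 : K / δ ≤ R := le_max_right _ _
    have hR : 0 < R := lt_of_lt_of_le (by positivity) hR2
    obtain ⟨h, -, hfac, hle⟩ := exists_log_factor hF hF0 hR (M := K + δ * R) (by positivity)
      (hKb R hR.le) S (fun s => ⟨fun hs => ⟨(hB s hs).trans_le hR1, (hS s).mp hs⟩,
        fun hs => (hS s).mpr hs.2⟩) (fun s hs => hd s ((hS s).mp hs))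
    have hw : w ∈ ball (0 : ℂ) R := by
      have := norm_nonneg w
      simpa using (by linarith : ‖w‖ < R)
    refine ⟨h w, (hle w hw).trans_lt ?_, hfac w hw⟩
    have hwn := norm_nonneg w
    rw [div_lt_iff₀ (by linarith)]
    rw [div_le_iff₀ hδ0] at hR3
    have h1 : 8 * δ * (‖w‖ + 1) = ε := by rw [hδ]; field_simp
    have h2 : 2 * (K + δ * R) * ‖w‖ ≤ 4 * δ * R * ‖w‖ := by nlinarith
    have h3 : ε * (R / 2) ≤ ε * (R - ‖w‖) := by
      apply mul_le_mul_of_nonneg_left _ hε.le; linarith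
    have h4 : ε * (R / 2) = 4 * δ * R * ‖w‖ + 4 * δ * R := by rw [← h1]; ring
    have : 0 < 4 * δ * R := by positivity
    linarith
  choose! v hv hFv using key
  have hlim : Tendsto (fun n : ℕ => v (1 / ((n : ℝ) + 1))) atTop (𝓝 0) := by
    refine squeeze_zero_norm (fun n => (hv _ (by positivity)).le) tendsto_one_div_add_atTop_nhds_zero_nat
  have h1 := (Complex.continuous_exp.tendsto 0).comp hlim
  have h2 := h1.const_mul (F 0 * ∏ s ∈ S, (1 - w / s))
  rw [Complex.exp_zero, mul_one] at h2
  refine tendsto_nhds_unique (tendsto_const_nhds (x := F w) |>.congr fun n => ?_) h2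
  exact hFv _ (by positivity)

/-! ### Exponential generating functions -/

/-- The exponential generating function of a sequence. -/
def egf (a : ℕ → ℂ) (w : ℂ) : ℂ := ∑' m : ℕ, a m / (m ! : ℂ) * w ^ m

section egf

variable {a : ℕ → ℂ} {C : ℝ}

lemma norm_egf_term_le {ε : ℝ} (h : ∀ m, ‖a m‖ ≤ C * ε ^ m) (w : ℂ) (m : ℕ) :
    ‖a m / (m ! : ℂ) * w ^ m‖ ≤ C * ((ε * ‖w‖) ^ m / (m ! : ℝ)) := by
  rw [norm_mul, norm_div, norm_pow, Complex.norm_natCast, mul_pow]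
  calc ‖a m‖ / (m ! : ℝ) * ‖w‖ ^ m ≤ C * ε ^ m / (m ! : ℝ) * ‖w‖ ^ m := by gcongr; exact h m
    _ = _ := by ring

lemma summable_norm_egf (h : ∀ m, ‖a m‖ ≤ C) (w : ℂ) :
    Summable fun m : ℕ => ‖a m / (m ! : ℂ) * w ^ m‖ :=
  .of_nonneg_of_le (fun _ => norm_nonneg _)
    (norm_egf_term_le (ε := 1) (by simpa using h) w)
    ((Real.summable_pow_div_factorial _).mul_left _)

lemma hasSum_egf (h : ∀ m, ‖a m‖ ≤ C) (w : ℂ) :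
    HasSum (fun m : ℕ => a m / (m ! : ℂ) * w ^ m) (egf a w) :=
  (summable_norm_egf h w).of_norm.hasSum

lemma hasDerivAt_egf (h : ∀ m, ‖a m‖ ≤ C) (w : ℂ) :
    HasDerivAt (egf a) (egf (fun m => a (m + 1)) w) w := by
  set R : ℝ := ‖w‖ + 1
  have hC : 0 ≤ C := (norm_nonneg _).trans (h 0)
  have hterm : ∀ (m : ℕ) (y : ℂ),
      a (m + 1) / ((m + 1)! : ℂ) * ((m + 1 : ℕ) * y ^ m) = a (m + 1) / (m ! : ℂ) * y ^ m := by
    intro m y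
    have h1 : (m ! : ℂ) ≠ 0 := by exact_mod_cast Nat.factorial_ne_zero m
    have h2 : ((m : ℂ) + 1) ≠ 0 := by exact_mod_cast Nat.succ_ne_zero m
    rw [Nat.factorial_succ]; push_cast; field_simp
  -- Majorant of the differentiated series on the ball; the entry 0 belongs to the constant term,
  -- and the others are shifted by one.
  let u : ℕ → ℝ := fun m => m.casesOn 0 fun m => C * ((1 * R) ^ m / (m ! : ℝ))
  have hu : Summable u := by
    rw [← summable_nat_add_iff 1]
    exact (Real.summable_pow_div_factorial _).mul_left _
  have hw : w ∈ ball (0 : ℂ) R := by simp [R]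
  have key := hasDerivAt_tsum_of_isPreconnected (𝕜 := ℂ) (t := ball (0 : ℂ) R) (u := u)
    (g := fun (m : ℕ) y => a m / (m ! : ℂ) * y ^ m)
    (g' := fun (m : ℕ) y => a m / (m ! : ℂ) * (m * y ^ (m - 1))) (y₀ := w) (y := w)
    hu isOpen_ball (convex_ball _ _).isPreconnected
    (fun m y _ => (hasDerivAt_pow m y).const_mul _) ?_ hw (hasSum_egf h w).summable hw
  · refine key.congr_deriv ?_
    have hs : Summable fun m : ℕ => a m / (m ! : ℂ) * (m * w ^ (m - 1)) := by
      rw [← summable_nat_add_iff 1]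
      simp only [Nat.add_sub_cancel, hterm]
      exact (hasSum_egf (fun m => h (m + 1)) w).summable
    rw [hs.tsum_eq_zero_add]
    simp only [Nat.add_sub_cancel, hterm]
    simp [egf]
  · intro m y hy
    have hyR : ‖y‖ ≤ R := by simpa using (mem_ball_zero_iff.mp hy).le
    cases m with
    | zero => simp [u]
    | succ m =>
      simp only [Nat.add_sub_cancel, hterm]
      refine (norm_egf_term_le (a := fun m => a (m + 1)) (C := C) (ε := 1)
        (by simpa using fun m => h (m + 1)) y m).trans ?_
      simp only [u]
      gcongr

lemma deriv_egf (h : ∀ m, ‖a m‖ ≤ C) : deriv (egf a) = egf (fun m => a (m + 1)) :=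
  funext fun w => (hasDerivAt_egf h w).deriv

lemma iteratedDeriv_egf (h : ∀ m, ‖a m‖ ≤ C) (n : ℕ) :
    iteratedDeriv n (egf a) = egf (fun m => a (m + n)) := by
  induction n with
  | zero => simp
  | succ n ih =>
    rw [iteratedDeriv_succ, ih, deriv_egf (fun m => h (m + n))]
    congr 1; funext m; congr 1; ring

/-- Coefficients bounded by C ε^m make the series at most C ∑ (ε|w|)^m / m! = C exp(ε|w|). -/
lemma minimalType_egf (h : ∀ ε : ℝ, 0 < ε → ∃ C : ℝ, ∀ m, ‖a m‖ ≤ C * ε ^ m) :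
    MinimalType (egf a) := by
  intro ε hε
  obtain ⟨C, hC⟩ := h ε hε
  refine ⟨C, fun w => ?_⟩
  have hs := (NormedSpace.expSeries_div_hasSum_exp (ε * ‖w‖)).mul_left C
  rw [← Real.exp_eq_exp_ℝ] at hs
  exact tsum_of_norm_bounded hs (norm_egf_term_le hC w)

end egf

/-! ### The entire function E_ν and its relation to J_ν and I_ν -/

/-- The coefficients `1 / Γ(m + ν + 1)`. -/
def besselCoeff (ν : ℂ) (m : ℕ) : ℂ := (Complex.Gamma (m + ν + 1))⁻¹

lemma besselCoeff_succ (ν : ℂ) (m : ℕ) : besselCoeff ν (m + 1) = besselCoeff (ν + 1) m := by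
  unfold besselCoeff; push_cast; congr 2; ring

/-- Valid for every ν, poles of Γ included, since 1/Γ is entire and vanishes there. The order -1
does occur later, as ν - 1 for ν = 0. -/
lemma besselCoeff_eq_mul (ν : ℂ) (m : ℕ) :
    besselCoeff ν m = (m + ν + 1) * besselCoeff ν (m + 1) := by
  unfold besselCoeff
  rw [Complex.one_div_Gamma_eq_self_mul_one_div_Gamma_add_one]
  push_cast; congr 3; ring

lemma exists_norm_besselCoeff_le (ν : ℂ) {ε : ℝ} (hε : 0 < ε) :
    ∃ C : ℝ, ∀ m, ‖besselCoeff ν m‖ ≤ C * ε ^ m := by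
  -- For m ≥ N one has |m + ν + 1| ≥ 1/ε, so each further coefficient gains a factor ε; C takes care
  -- of the indices up to N.
  obtain ⟨N, hN⟩ := exists_nat_gt (1 / ε + ‖ν + 1‖)
  set C := ∑ i ∈ Finset.range (N + 1), ‖besselCoeff ν i‖ / ε ^ i with hC
  refine ⟨C, fun m => ?_⟩
  induction m with
  | zero =>
    have := Finset.single_le_sum (f := fun i => ‖besselCoeff ν i‖ / ε ^ i)
      (fun i _ => by positivity) (Finset.mem_range.mpr (Nat.succ_pos N))
    simpa using this
  | succ m ih =>
    by_cases hm : m < N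
    · have := Finset.single_le_sum (f := fun i => ‖besselCoeff ν i‖ / ε ^ i)
        (fun i _ => by positivity) (Finset.mem_range.mpr (Nat.succ_lt_succ hm))
      rwa [div_le_iff₀ (by positivity)] at this
    · have hm' : (N : ℝ) ≤ m := by exact_mod_cast not_lt.mp hm
      rw [besselCoeff_eq_mul, norm_mul] at ih
      have h1 : 1 / ε ≤ ‖(m : ℂ) + ν + 1‖ := by
        have h2 := norm_sub_norm_le (m : ℂ) (-(ν + 1))
        rw [norm_neg, Complex.norm_natCast] at h2
        have h3 : (m : ℂ) - -(ν + 1) = m + ν + 1 := by ring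
        rw [h3] at h2
        linarith
      have h4 : 1 / ε * ‖besselCoeff ν (m + 1)‖ ≤ C * ε ^ m :=
        (mul_le_mul_of_nonneg_right h1 (norm_nonneg _)).trans ih
      have h5 : ‖besselCoeff ν (m + 1)‖ = ε * (1 / ε * ‖besselCoeff ν (m + 1)‖) := by field_simp
      rw [h5, pow_succ]
      calc _ ≤ ε * (C * ε ^ m) := by gcongr
        _ = _ := by ring

lemma exists_norm_besselCoeff_le_const (ν : ℂ) : ∃ C : ℝ, ∀ m, ‖besselCoeff ν m‖ ≤ C := by
  simpa using exists_norm_besselCoeff_le ν one_pos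

/-- The entire function `∑ w ^ m / (m! Γ(m + ν + 1))`. -/
def besselE (ν w : ℂ) : ℂ := egf (besselCoeff ν) w

lemma hasSum_besselE (ν w : ℂ) :
    HasSum (fun m : ℕ => besselCoeff ν m / (m ! : ℂ) * w ^ m) (besselE ν w) :=
  hasSum_egf (exists_norm_besselCoeff_le_const ν).choose_spec w

lemma hasDerivAt_besselE (ν w : ℂ) : HasDerivAt (besselE ν) (besselE (ν + 1) w) w := by
  have := hasDerivAt_egf (exists_norm_besselCoeff_le_const ν).choose_spec w
  simp only [besselCoeff_succ] at this
  exact this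

lemma deriv_besselE (ν w : ℂ) : deriv (besselE ν) w = besselE (ν + 1) w :=
  (hasDerivAt_besselE ν w).deriv

lemma differentiable_besselE (ν : ℂ) : Differentiable ℂ (besselE ν) :=
  fun w => (hasDerivAt_besselE ν w).differentiableAt

lemma minimalType_besselE (ν : ℂ) : MinimalType (besselE ν) :=
  minimalType_egf fun _ => exists_norm_besselCoeff_le ν

lemma iteratedDeriv_besselE (ν : ℂ) (n : ℕ) : iteratedDeriv n (besselE ν) = besselE (ν + n) := by
  have h := iteratedDeriv_egf (exists_norm_besselCoeff_le_const ν).choose_spec n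
  change iteratedDeriv n (egf (besselCoeff ν)) = egf (besselCoeff (ν + n))
  rw [h]
  congr 1; funext m
  unfold besselCoeff; push_cast; congr 2; ring

/-- The three-term recurrence in the order. -/
lemma besselE_eq_add (ν w : ℂ) :
    besselE ν w = (ν + 1) * besselE (ν + 1) w + w * besselE (ν + 2) w := by
  have h1 : HasSum (fun m : ℕ => (m : ℂ) * besselCoeff (ν + 1) m / (m ! : ℂ) * w ^ m)
      (w * besselE (ν + 2) w) := by
    rw [← hasSum_nat_add_iff' 1]
    simp only [Finset.range_one, Finset.sum_singleton, Nat.cast_zero, zero_mul, zero_div, sub_zero]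
    refine ((hasSum_besselE (ν + 2) w).mul_left w).congr_fun fun m => ?_
    have e : ν + 2 = ν + 1 + 1 := by ring
    rw [e, ← besselCoeff_succ (ν + 1) m, Nat.factorial_succ]
    have h1 : (m ! : ℂ) ≠ 0 := by exact_mod_cast Nat.factorial_ne_zero m
    have h2 : ((m : ℂ) + 1) ≠ 0 := by exact_mod_cast Nat.succ_ne_zero m
    push_cast; field_simp; ring
  have h2 := ((hasSum_besselE (ν + 1) w).mul_left (ν + 1)).add h1
  refine (hasSum_besselE ν w).unique (h2.congr_fun fun m => ?_)
  rw [besselCoeff_eq_mul, besselCoeff_succ]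
  ring

lemma half_cpow_two_mul_add {z : ℂ} (hz : z ≠ 0) (ν : ℂ) (m : ℕ) :
    (z / 2) ^ (2 * (m : ℂ) + ν) = (z / 2) ^ ν * (z ^ 2 / 4) ^ m := by
  have h2 : z / 2 ≠ 0 := by simpa using hz
  rw [Complex.cpow_add _ _ h2, mul_comm]
  congr 1
  have : (2 * (m : ℂ)) = ((2 * m : ℕ) : ℂ) := by push_cast; ring
  rw [this, Complex.cpow_natCast, pow_mul]
  congr 1; ring

lemma besselJ_eq {z : ℂ} (hz : z ≠ 0) (ν : ℂ) :
    besselJ ν z = (z / 2) ^ ν * besselE ν (-(z ^ 2 / 4)) := by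
  rw [besselE, egf, ← tsum_mul_left, besselJ]
  refine tsum_congr fun m => ?_
  rw [half_cpow_two_mul_add hz, besselCoeff, neg_pow (z ^ 2 / 4)]
  field_simp

lemma besselI_eq {z : ℂ} (hz : z ≠ 0) (ν : ℂ) :
    besselI ν z = (z / 2) ^ ν * besselE ν (z ^ 2 / 4) := by
  rw [besselE, egf, ← tsum_mul_left, besselI]
  refine tsum_congr fun m => ?_
  rw [half_cpow_two_mul_add hz, besselCoeff]
  field_simp

lemma half_cpow_ne_zero {z : ℂ} (hz : z ≠ 0) (ν : ℂ) : (z / 2) ^ ν ≠ 0 := by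
  rw [Complex.cpow_def_of_ne_zero (by simpa using hz)]; exact Complex.exp_ne_zero _

lemma besselJ_eq_zero_iff {z : ℂ} (hz : z ≠ 0) (ν : ℂ) :
    besselJ ν z = 0 ↔ besselE ν (-(z ^ 2 / 4)) = 0 := by
  rw [besselJ_eq hz, mul_eq_zero, or_iff_right (half_cpow_ne_zero hz ν)]

/-- The quotient of consecutive modified Bessel functions. -/
lemma besselI_sub_one_div {z : ℂ} (hz : z ≠ 0) (ν : ℂ) :
    besselI (ν - 1) z / besselI ν z = 2 / z * (besselE (ν - 1) (z ^ 2 / 4) / besselE ν (z ^ 2 / 4)) := by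
  have h2 : z / 2 ≠ 0 := by simpa using hz
  have h3 := half_cpow_ne_zero hz ν
  rw [besselI_eq hz, besselI_eq hz, Complex.cpow_sub _ _ h2, Complex.cpow_one]
  field_simp

/-! ### Zeros of E_ν for ν > -1: negative and simple -/

lemma conj_besselE (ν : ℝ) (w : ℂ) :
    (starRingEnd ℂ) (besselE ν w) = besselE ν ((starRingEnd ℂ) w) := by
  rw [besselE, egf, besselE, egf, Complex.conj_tsum]
  refine tsum_congr fun m => ?_
  simp [besselCoeff, ← Complex.Gamma_conj]

/-- All Taylor coefficients are positive, because m + ν + 1 > 0. -/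
lemma exists_pos_besselE {ν : ℝ} (hν : -1 < ν) {x : ℝ} (hx : 0 ≤ x) :
    ∃ r : ℝ, 0 < r ∧ besselE ν x = r := by
  have h := hasSum_besselE ν x
  have hterm : ∀ m : ℕ, besselCoeff ν m / (m ! : ℂ) * (x : ℂ) ^ m
      = (((Real.Gamma (m + ν + 1))⁻¹ / (m ! : ℝ) * x ^ m : ℝ) : ℂ) := by
    intro m
    push_cast
    rw [besselCoeff, ← Complex.Gamma_ofReal]; push_cast; rfl
  have hpos : ∀ m : ℕ, 0 < Real.Gamma (m + ν + 1) := fun m =>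
    Real.Gamma_pos_of_pos (by have := Nat.cast_nonneg (α := ℝ) m; linarith)
  simp only [hterm] at h
  have hs := Complex.summable_ofReal.mp h.summable
  refine ⟨_, ?_, (h.unique (Complex.hasSum_ofReal.mpr hs.hasSum))⟩
  refine hs.tsum_pos (fun m => ?_) 0 ?_
  · have := hpos m; positivity
  · have := hpos 0; simpa using this

lemma besselE_ne_zero_of_nonneg {ν : ℝ} (hν : -1 < ν) {x : ℝ} (hx : 0 ≤ x) : besselE ν x ≠ 0 := by
  obtain ⟨r, hr, h⟩ := exists_pos_besselE hν hx
  rw [h]; exact_mod_cast hr.ne'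

/-- Zeros of `besselE ν` are simple. -/
lemma deriv_besselE_ne_zero {ν : ℝ} (hν : -1 < ν) {a : ℂ} (ha : besselE ν a = 0) :
    deriv (besselE ν) a ≠ 0 := by
  intro hd
  rw [deriv_besselE] at hd
  have h00 := besselE_ne_zero_of_nonneg hν le_rfl
  have ha0 : a ≠ 0 := by
    rintro rfl; simp [ha] at h00
  have key : ∀ n : ℕ, besselE (ν + n) a = 0 ∧ besselE (ν + n + 1) a = 0 := by
    intro n
    induction n with
    | zero => simpa using ⟨ha, hd⟩
    | succ n ih =>
      have h := besselE_eq_add (ν + n) a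
      rw [ih.1, ih.2, mul_zero, zero_add, zero_eq_mul, or_iff_right ha0] at h
      push_cast
      refine ⟨by rw [← ih.2]; congr 1; ring, by rw [← h]; congr 1; ring⟩
  have ht := Complex.taylorSeries_eq_of_entire' a 0 (differentiable_besselE ν)
  simp only [iteratedDeriv_besselE, (key _).1, mul_zero, zero_mul, tsum_zero] at ht
  simp [← ht] at h00

/-- Zeros of `besselE ν` are real. -/
lemma im_eq_zero_of_besselE_eq_zero {ν : ℝ} (hν : -1 < ν) {a : ℂ} (ha : besselE ν a = 0) :
    a.im = 0 := by
  by_contra him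
  set b := (starRingEnd ℂ) a with hb
  have hconj : ∀ t : ℝ, besselE ν (b * t) = (starRingEnd ℂ) (besselE ν (a * t)) := by
    intro t; rw [conj_besselE]; simp [hb]
  have hconj1 : ∀ t : ℝ, besselE (ν + 1) (b * t) = (starRingEnd ℂ) (besselE (ν + 1) (a * t)) := by
    intro t
    have := conj_besselE (ν + 1) (a * t)
    push_cast at this
    rw [this]; simp [hb]
  have hder : ∀ (μ c : ℂ) (t : ℝ),
      HasDerivAt (fun t : ℝ => besselE μ (c * t)) (c * besselE (μ + 1) (c * t)) t := by
    intro μ c t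
    have h1 : HasDerivAt (fun z : ℂ => besselE μ (c * z)) (c * besselE (μ + 1) (c * t)) t := by
      have := (hasDerivAt_besselE μ (c * t)).comp (t : ℂ) ((hasDerivAt_id (t : ℂ)).const_mul c)
      refine this.congr_deriv (by ring)
    exact h1.comp_ofReal
  -- A Sturm–Liouville argument. The function u(t) = E_ν(at) satisfies (t^{ν+1} u')' = a t^ν u, and
  -- K is u' times the conjugate of u. The part of (t^{ν+1} K)' containing |u'|² is real, so only a
  -- t^ν |u|² contributes to the imaginary part.
  let K : ℝ → ℂ := fun t => a * besselE (ν + 1) (a * t) * besselE ν (b * t)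
  have hK : ∀ t : ℝ, HasDerivAt K (a * (a * besselE (ν + 1 + 1) (a * t)) * besselE ν (b * t)
      + a * besselE (ν + 1) (a * t) * (b * besselE (ν + 1) (b * t))) t := fun t =>
    ((hder (ν + 1) a t).const_mul a).fun_mul (hder ν b t)
  let G : ℝ → ℝ := fun t => a.im * (t ^ (ν + 1) * (K t).im)
  have hG : ∀ t : ℝ, 0 < t →
      HasDerivAt G (a.im ^ 2 * (t ^ ν * Complex.normSq (besselE ν (a * t)))) t := by
    intro t ht
    have h1 := (Complex.imCLM.hasFDerivAt.comp_hasDerivAt t (hK t))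
    have h2 := Real.hasDerivAt_rpow_const (x := t) (p := ν + 1) (Or.inl ht.ne')
    have h3 := (h2.fun_mul h1).const_mul a.im
    refine h3.congr_deriv ?_
    have hode := besselE_eq_add ν (a * t)
    have e2 : (ν : ℂ) + 1 + 1 = ν + 2 := by ring
    have e3 : t ^ (ν + 1) = t ^ ν * t := by rw [Real.rpow_add ht, Real.rpow_one]
    have e4 : (K t).im * (ν + 1) + t * (a * (a * besselE (ν + 1 + 1) (a * t)) * besselE ν (b * t)
        + a * besselE (ν + 1) (a * t) * (b * besselE (ν + 1) (b * t))).im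
        = a.im * Complex.normSq (besselE ν (a * t)) := by
      have e5 : (K t * ((ν + 1 : ℝ) : ℂ) + (t : ℂ) * (a * (a * besselE (ν + 1 + 1) (a * t)) * besselE ν (b * t)
        + a * besselE (ν + 1) (a * t) * (b * besselE (ν + 1) (b * t))))
        = a * (Complex.normSq (besselE ν (a * t)) : ℂ)
          + ((t * (Complex.normSq a * Complex.normSq (besselE (ν + 1) (a * t))) : ℝ) : ℂ) := by
        push_cast
        rw [Complex.normSq_eq_conj_mul_self, Complex.normSq_eq_conj_mul_self,
          Complex.normSq_eq_conj_mul_self, ← hconj, ← hconj1, ← hb, e2]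
        simp only [K]
        linear_combination (-a * besselE ν (b * t)) * hode
      have e6 := congrArg Complex.im e5
      simpa only [Complex.add_im, Complex.re_mul_ofReal, Complex.im_mul_ofReal,
        Complex.im_ofReal_mul, Complex.ofReal_im, add_zero] using e6
    simp only [Complex.imCLM_apply, Function.comp, add_sub_cancel_right]
    rw [e3]
    linear_combination (a.im * t ^ ν) * e4
  have hKc : Continuous K := continuous_iff_continuousAt.mpr fun t => (hK t).continuousAt
  have hGc : Continuous G := by
    have : Continuous fun t : ℝ => t ^ (ν + 1) :=
      Real.continuous_rpow_const (by linarith)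
    fun_prop
  -- G is nondecreasing and vanishes at both ends: at 0 because ν + 1 > 0, at 1 because u(1) = 0. So
  -- G, and with it G', vanishes inside, which forces u = 0 and contradicts E_ν(0) ≠ 0.
  have hmono : MonotoneOn G (Set.Icc 0 1) := by
    refine monotoneOn_of_deriv_nonneg (convex_Icc 0 1) hGc.continuousOn ?_ ?_
    · rw [interior_Icc]
      exact fun t ht => (hG t ht.1).differentiableAt.differentiableWithinAt
    · rw [interior_Icc]
      intro t ht
      rw [(hG t ht.1).deriv]
      have := Complex.normSq_nonneg (besselE ν (a * t))
      have := Real.rpow_nonneg ht.1.le ν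
      positivity
  have hG0 : G 0 = 0 := by simp [G, Real.zero_rpow (by linarith : ν + 1 ≠ 0)]
  have hG1 : G 1 = 0 := by
    have := hconj 1
    simp only [Complex.ofReal_one, mul_one, ha, map_zero] at this
    simp [G, K, this]
  have hGz : ∀ t ∈ Set.Icc (0 : ℝ) 1, G t = 0 := by
    intro t ht
    have h1 := hmono (Set.left_mem_Icc.mpr zero_le_one) ht ht.1
    have h2 := hmono ht (Set.right_mem_Icc.mpr zero_le_one) ht.2
    rw [hG0] at h1; rw [hG1] at h2
    exact le_antisymm h2 h1
  have hu : ∀ t ∈ Set.Ioo (0 : ℝ) 1, besselE ν (a * t) = 0 := by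
    intro t ht
    have h1 : G =ᶠ[𝓝 t] fun _ => 0 :=
      Filter.eventually_of_mem (Ioo_mem_nhds ht.1 ht.2) fun s hs => hGz s (Set.Ioo_subset_Icc_self hs)
    have h2 := (hG t ht.1).unique ((hasDerivAt_const t (0 : ℝ)).congr_of_eventuallyEq h1)
    have h3 := Real.rpow_pos_of_pos ht.1 ν
    simpa [him, h3.ne'] using h2
  have hcont : Continuous fun t : ℝ => besselE ν (a * t) :=
    continuous_iff_continuousAt.mpr fun t => (hder ν a t).continuousAt
  have h0 : besselE ν (a * (0 : ℝ)) = 0 := by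
    have hcl : (0 : ℝ) ∈ closure (Set.Ioo (0 : ℝ) 1) := by
      rw [closure_Ioo zero_ne_one]; simp
    exact (closure_minimal hu (isClosed_singleton.preimage hcont)) hcl
  simp only [Complex.ofReal_zero, mul_zero] at h0
  exact besselE_ne_zero_of_nonneg hν le_rfl (by simpa using h0)

/-! ### Enumeration of the positive elements of a locally finite set -/

lemma nthPositive_isLeast {S : Set ℝ} (hfin : ∀ B : ℝ, {x : ℝ | x ∈ S ∧ 0 < x ∧ x ≤ B}.Finite)
    (hinf : {x : ℝ | x ∈ S ∧ 0 < x}.Infinite) (n : ℕ) : 0 ≤ nthPositive S n ∧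
      IsLeast {x : ℝ | nthPositive S n < x ∧ x ∈ S} (nthPositive S (n + 1)) := by
  -- The infimum is attained: some element x of S exceeds c, and only finitely many elements lie in
  -- (c, x].
  have step : ∀ c : ℝ, 0 ≤ c → IsLeast {x : ℝ | c < x ∧ x ∈ S} (sInf {x : ℝ | c < x ∧ x ∈ S}) := by
    intro c hc
    obtain ⟨x, hx, hxc⟩ := (hinf.sdiff (hfin c)).nonempty
    have hcx : c < x := by
      by_contra h
      exact hxc ⟨hx.1, hx.2, not_lt.mp h⟩
    have hF : {y : ℝ | y ∈ S ∧ c < y ∧ y ≤ x}.Finite :=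
      (hfin x).subset fun y hy => ⟨hy.1, hc.trans_lt hy.2.1, hy.2.2⟩
    obtain ⟨m, hm, hmin⟩ := Set.exists_min_image _ id hF ⟨x, hx.1, hcx, le_rfl⟩
    have hl : IsLeast {x : ℝ | c < x ∧ x ∈ S} m := by
      refine ⟨⟨hm.2.1, hm.1⟩, fun y hy => ?_⟩
      by_cases hyx : y ≤ x
      · exact hmin y ⟨hy.2, hy.1, hyx⟩
      · exact hm.2.2.trans (not_le.mp hyx).le
    rwa [hl.csInf_eq]
  induction n with
  | zero => exact ⟨le_rfl, step 0 le_rfl⟩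
  | succ n ih =>
    have h : 0 ≤ nthPositive S (n + 1) := ih.1.trans ih.2.1.1.le
    exact ⟨h, step _ h⟩

lemma strictMono_nthPositive {S : Set ℝ}
    (hfin : ∀ B : ℝ, {x : ℝ | x ∈ S ∧ 0 < x ∧ x ≤ B}.Finite)
    (hinf : {x : ℝ | x ∈ S ∧ 0 < x}.Infinite) : StrictMono (nthPositive S) :=
  strictMono_nat_of_lt_succ fun n => (nthPositive_isLeast hfin hinf n).2.1.1

lemma exists_lt_nthPositive {S : Set ℝ}
    (hfin : ∀ B : ℝ, {x : ℝ | x ∈ S ∧ 0 < x ∧ x ≤ B}.Finite)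
    (hinf : {x : ℝ | x ∈ S ∧ 0 < x}.Infinite) (B : ℝ) : ∃ n, B ≤ nthPositive S n := by
  by_contra! h
  have hm := strictMono_nthPositive hfin hinf
  refine Set.infinite_of_injective_forall_mem (f := fun n : ℕ => nthPositive S (n + 1))
    (hm.injective.comp (add_left_injective 1)) (fun n => ?_) (hfin B)
  have h1 := nthPositive_isLeast hfin hinf n
  exact ⟨h1.2.1.2, h1.1.trans_lt h1.2.1.1, (h _).le⟩

lemma mem_iff_exists_nthPositive {S : Set ℝ}
    (hfin : ∀ B : ℝ, {x : ℝ | x ∈ S ∧ 0 < x ∧ x ≤ B}.Finite)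
    (hinf : {x : ℝ | x ∈ S ∧ 0 < x}.Infinite) {x : ℝ} (hx : 0 < x) :
    x ∈ S ↔ ∃ n : ℕ, 1 ≤ n ∧ x = nthPositive S n := by
  classical
  constructor
  · intro hxS
    have hex := exists_lt_nthPositive hfin hinf x
    obtain ⟨n, hn⟩ : ∃ n, Nat.find hex = n + 1 := by
      refine Nat.exists_eq_succ_of_ne_zero fun h0 => ?_
      have := Nat.find_spec hex
      rw [h0] at this
      exact absurd hx (not_lt.mpr this)
    have h1 := Nat.find_spec hex
    have h2 := Nat.find_min hex (m := n) (by omega)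
    rw [hn] at h1
    exact ⟨n + 1, by omega, le_antisymm h1
      ((nthPositive_isLeast hfin hinf n).2.2 ⟨not_le.mp h2, hxS⟩)⟩
  · rintro ⟨n, hn, rfl⟩
    obtain ⟨n, rfl⟩ := Nat.exists_eq_add_of_le' hn
    exact (nthPositive_isLeast hfin hinf n).2.1.2

lemma nthPositive_eq {S : Set ℝ} {f : ℕ → ℝ} (hf : StrictMono f) (hf0 : f 0 = 0)
    (hS : ∀ x : ℝ, 0 < x → (x ∈ S ↔ ∃ n : ℕ, 1 ≤ n ∧ x = f n)) : nthPositive S = f := by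
  funext n
  induction n with
  | zero => exact hf0.symm
  | succ n ih =>
    have hn : 0 ≤ f n := hf0 ▸ hf.monotone (Nat.zero_le n)
    have hl : IsLeast {x : ℝ | nthPositive S n < x ∧ x ∈ S} (f (n + 1)) := by
      rw [ih]
      refine ⟨⟨hf (Nat.lt_succ_self n), (hS _ (hn.trans_lt (hf (Nat.lt_succ_self n)))).mpr
        ⟨n + 1, by omega, rfl⟩⟩, ?_⟩
      rintro x ⟨hx, hxS⟩
      obtain ⟨m, -, rfl⟩ := (hS x (hn.trans_lt hx)).mp hxS
      exact hf.monotone (hf.lt_iff_lt.mp hx)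
    exact hl.csInf_eq

/-- Only positive elements matter, so the sets may differ elsewhere. The nonnegativity is part of
the induction, as it guarantees that every competitor for the next infimum is positive. -/
lemma nthPositive_congr {S T : Set ℝ} (h : ∀ x : ℝ, 0 < x → (x ∈ S ↔ x ∈ T))
    (n : ℕ) : nthPositive S n = nthPositive T n ∧ 0 ≤ nthPositive S n := by
  induction n with
  | zero => exact ⟨rfl, le_rfl⟩
  | succ n ih =>
    have e : {x : ℝ | nthPositive S n < x ∧ x ∈ S} = {x : ℝ | nthPositive T n < x ∧ x ∈ T} := by
      ext x
      rw [Set.mem_ofPred_eq, Set.mem_ofPred_eq, ← ih.1]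
      exact and_congr_right fun hx => h x (ih.2.trans_lt hx)
    refine ⟨congrArg sInf e, Real.sInf_nonneg fun x hx => ih.2.trans hx.1.le⟩

/-! ### The sequence of Bessel zeros and partial fractions -/

/-- Zeros of a nonzero entire function in a disc. -/
lemma finite_zeros_closedBall {F : ℂ → ℂ} (hF : Differentiable ℂ F) (hF0 : F 0 ≠ 0) (R : ℝ) :
    {w : ℂ | F w = 0 ∧ ‖w‖ ≤ R}.Finite := by
  by_contra hinf
  obtain ⟨x, -, hx⟩ := Set.Infinite.exists_accPt_of_subset_isCompact hinf
    (isCompact_closedBall (0 : ℂ) R) (fun w hw => by simpa using hw.2)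
  rw [accPt_iff_frequently_nhdsNE] at hx
  have han : AnalyticOnNhd ℂ F Set.univ := hF.differentiableOn.analyticOnNhd isOpen_univ
  have h0 := han.eqOn_zero_of_preconnected_of_frequently_eq_zero isPreconnected_univ
    (Set.mem_univ x) (hx.mono fun y hy => hy.1)
  exact hF0 (h0 (Set.mem_univ 0))

lemma iteratedDeriv_polynomial (p : Polynomial ℂ) (k : ℕ) :
    iteratedDeriv k (fun x => p.eval x) = fun x => (Polynomial.derivative^[k] p).eval x := by
  induction k with
  | zero => simp
  | succ k ih =>
    rw [iteratedDeriv_succ, ih, Function.iterate_succ_apply']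
    funext x
    exact Polynomial.deriv _

/-- With finitely many zeros E_ν would be a polynomial. A high derivative, which is E_{ν+n}, would
vanish identically, although E_{ν+n}(0) > 0. -/
lemma infinite_zeros_besselE {ν : ℝ} (hν : -1 < ν) : {w : ℂ | besselE ν w = 0}.Infinite := by
  intro hfin
  have h00 : besselE ν 0 ≠ 0 := by simpa using besselE_ne_zero_of_nonneg hν le_rfl
  have hprod := (minimalType_besselE ν).eq_prod (differentiable_besselE ν) h00
    (fun s hs => deriv_besselE_ne_zero hν hs) hfin.toFinset (by simp)
  let p : Polynomial ℂ := Polynomial.C (besselE ν 0) *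
    ∏ s ∈ hfin.toFinset, (1 - Polynomial.C (1 / s) * Polynomial.X)
  have hp : besselE ν = fun w => p.eval w := by
    funext w
    rw [hprod w]
    simp only [p, Polynomial.eval_mul, Polynomial.eval_C, Polynomial.eval_prod,
      Polynomial.eval_sub, Polynomial.eval_one, Polynomial.eval_X]
    congr 1
    exact Finset.prod_congr rfl fun s _ => by ring
  have h1 := iteratedDeriv_besselE ν (p.natDegree + 1)
  rw [hp, iteratedDeriv_polynomial, Polynomial.iterate_derivative_eq_zero (Nat.lt_succ_self _)] at h1
  have h2 := congrFun h1 0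
  have h3 := besselE_ne_zero_of_nonneg (ν := ν + (p.natDegree + 1 : ℕ)) (x := 0)
    (by have := Nat.cast_nonneg (α := ℝ) (p.natDegree + 1); linarith) le_rfl
  refine h3 ?_
  push_cast at h2 ⊢
  rw [← h2]; simp

section zeros

variable {ν : ℝ} (hν : -1 < ν)

include hν

lemma besselJ_zeros_finite (B : ℝ) :
    {x : ℝ | x ∈ {x : ℝ | besselJ ν x = 0} ∧ 0 < x ∧ x ≤ B}.Finite := by
  have h00 : besselE ν 0 ≠ 0 := by simpa using besselE_ne_zero_of_nonneg hν le_rfl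
  refine Set.Finite.of_finite_image (f := fun x : ℝ => (-((x : ℂ) ^ 2 / 4)))
    ((finite_zeros_closedBall (differentiable_besselE ν) h00 (B ^ 2 / 4)).subset ?_) ?_
  · rintro _ ⟨x, ⟨hJ, hx, hxB⟩, rfl⟩
    refine ⟨(besselJ_eq_zero_iff (by exact_mod_cast hx.ne') _).mp hJ, ?_⟩
    simp only [norm_neg, norm_div, norm_pow, Complex.norm_real, Real.norm_eq_abs, sq_abs]
    rw [show ‖(4 : ℂ)‖ = 4 by simp]
    gcongr
  · rintro x ⟨-, hx, -⟩ y ⟨-, hy, -⟩ hxy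
    simp only [neg_inj] at hxy
    have : x ^ 2 = y ^ 2 := by
      have h : (x : ℂ) ^ 2 = (y : ℂ) ^ 2 := by linear_combination 4 * hxy
      exact_mod_cast h
    exact (pow_left_inj₀ hx.le hy.le two_ne_zero).mp this

/-- A zero is real and cannot be nonnegative, so x = 2√(-w) is available. -/
lemma exists_of_besselE_eq_zero {w : ℂ} (hw : besselE ν w = 0) :
    ∃ x : ℝ, 0 < x ∧ w = -((x : ℂ) ^ 2 / 4) ∧ besselJ ν x = 0 := by
  have him := im_eq_zero_of_besselE_eq_zero hν hw
  have hwre : w = (w.re : ℂ) := Complex.ext rfl (by simpa using him)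
  have hneg : w.re < 0 := by
    by_contra h
    exact besselE_ne_zero_of_nonneg hν (not_lt.mp h) (hwre ▸ hw)
  have hx : 0 < 2 * √(-w.re) := by
    have := Real.sqrt_pos.mpr (neg_pos.mpr hneg); positivity
  have hwx : w = -(((2 * √(-w.re) : ℝ) : ℂ) ^ 2 / 4) := by
    have h1 : (2 * √(-w.re)) ^ 2 / 4 = -w.re := by
      rw [mul_pow, Real.sq_sqrt (by linarith)]; ring
    have h2 : ((2 * √(-w.re) : ℝ) : ℂ) ^ 2 / 4 = ((-w.re : ℝ) : ℂ) := by
      have := congrArg Complex.ofReal h1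
      rwa [Complex.ofReal_div, Complex.ofReal_pow, Complex.ofReal_ofNat] at this
    rw [h2]; push_cast; rw [neg_neg]; exact hwre
  exact ⟨_, hx, hwx, (besselJ_eq_zero_iff (by exact_mod_cast hx.ne') _).mpr (hwx ▸ hw)⟩

lemma besselJ_zeros_infinite : {x : ℝ | x ∈ {x : ℝ | besselJ ν x = 0} ∧ 0 < x}.Infinite := by
  intro hfin
  refine infinite_zeros_besselE hν ((hfin.image fun x : ℝ => (-((x : ℂ) ^ 2 / 4))).subset ?_)
  intro w hw
  obtain ⟨x, hx, hwx, hJ⟩ := exists_of_besselE_eq_zero hν hw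
  exact ⟨x, ⟨hJ, hx⟩, hwx.symm⟩

lemma strictMono_besselJZero : StrictMono (besselJZero ν) :=
  strictMono_nthPositive (besselJ_zeros_finite hν) (besselJ_zeros_infinite hν)

lemma besselJ_eq_zero_iff_exists {x : ℝ} (hx : 0 < x) :
    besselJ ν x = 0 ↔ ∃ n : ℕ, 1 ≤ n ∧ x = besselJZero ν n :=
  mem_iff_exists_nthPositive (besselJ_zeros_finite hν) (besselJ_zeros_infinite hν) hx

lemma besselJZero_pos (n : ℕ) : 0 < besselJZero ν (n + 1) :=
  strictMono_besselJZero hν (Nat.succ_pos n)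

lemma tendsto_besselJZero : Tendsto (besselJZero ν) atTop atTop :=
  tendsto_atTop_atTop_of_monotone (strictMono_besselJZero hν).monotone
    (exists_lt_nthPositive (besselJ_zeros_finite hν) (besselJ_zeros_infinite hν))

lemma besselE_eq_zero_iff {w : ℂ} :
    besselE ν w = 0 ↔ ∃ n : ℕ, w = -((besselJZero ν (n + 1) : ℂ) ^ 2 / 4) := by
  constructor
  · intro hw
    obtain ⟨x, hx, hwx, hJ⟩ := exists_of_besselE_eq_zero hν hw
    obtain ⟨n, hn, rfl⟩ := (besselJ_eq_zero_iff_exists hν hx).mp hJ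
    obtain ⟨n, rfl⟩ := Nat.exists_eq_add_of_le' hn
    exact ⟨n, hwx⟩
  · rintro ⟨n, rfl⟩
    have hp := besselJZero_pos hν n
    rw [← besselJ_eq_zero_iff (by exact_mod_cast hp.ne')]
    exact (besselJ_eq_zero_iff_exists hν hp).mpr ⟨n + 1, by omega, rfl⟩

/-- The logarithmic derivative of `besselE ν` as a sum over the zeros. -/
lemma exists_hasSum_inv {y : ℝ} (hy : 0 ≤ y) : ∃ T : ℝ,
    HasSum (fun n : ℕ => 1 / (y + besselJZero ν (n + 1) ^ 2 / 4)) T ∧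
      besselE (ν + 1) y = T * besselE ν y := by
  classical
  have h00 : besselE ν 0 ≠ 0 := by simpa using besselE_ne_zero_of_nonneg hν le_rfl
  have hy0 := besselE_ne_zero_of_nonneg hν hy
  set l : ℕ → ℝ := fun n => besselJZero ν (n + 1) ^ 2 / 4 with hl
  have hlpos : ∀ n, 0 < l n := fun n => by have := besselJZero_pos hν n; positivity
  have hlm : StrictMono l := by
    intro m n hmn
    have h1 := besselJZero_pos hν m
    have h2 := strictMono_besselJZero hν (Nat.succ_lt_succ hmn)
    simp only [hl]
    gcongr
  have hlt : Tendsto l atTop atTop := by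
    have h1 := (tendsto_add_atTop_iff_nat 1).mpr (tendsto_besselJZero hν)
    exact ((tendsto_pow_atTop two_ne_zero).comp h1).atTop_div_const (by norm_num)
  let f : ℕ → ℂ := fun n => -(l n : ℂ)
  have hf : Function.Injective f := fun m n h => hlm.injective (by simpa [f] using h)
  -- The disc of radius l k contains exactly the zeros with indices below k, so the sums over discs
  -- are the ordinary partial sums.
  have hS : ∀ k s, s ∈ (Finset.range k).image f ↔ ‖s‖ < l k ∧ besselE ν s = 0 := by
    intro k s
    simp only [Finset.mem_image, Finset.mem_range]
    constructor
    · rintro ⟨n, hn, rfl⟩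
      refine ⟨?_, (besselE_eq_zero_iff hν).mpr ⟨n, by simp [f, hl]⟩⟩
      simp only [f, norm_neg, Complex.norm_real, Real.norm_eq_abs, abs_of_pos (hlpos n)]
      exact hlm hn
    · rintro ⟨hs, hE⟩
      obtain ⟨n, rfl⟩ := (besselE_eq_zero_iff hν).mp hE
      have e : -((besselJZero ν (n + 1) : ℂ) ^ 2 / 4) = f n := by simp [f, hl]
      rw [e] at hs ⊢
      simp only [f, norm_neg, Complex.norm_real, Real.norm_eq_abs, abs_of_pos (hlpos n)] at hs
      exact ⟨n, hlm.lt_iff_lt.mp hs, rfl⟩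
  have hlim := (minimalType_besselE ν).tendsto_sum_inv (differentiable_besselE ν) h00
    (fun s hs => deriv_besselE_ne_zero hν hs) hlt hS hy0
  obtain ⟨r, hr, hEr⟩ := exists_pos_besselE hν hy
  obtain ⟨r', hr', hEr'⟩ := exists_pos_besselE (ν := ν + 1) (by linarith) hy
  push_cast at hEr'
  have hsum : ∀ k, ∑ s ∈ (Finset.range k).image f, 1 / ((y : ℂ) - s)
      = ((∑ n ∈ Finset.range k, 1 / (y + l n) : ℝ) : ℂ) := by
    intro k
    rw [Finset.sum_image hf.injOn]
    push_cast
    exact Finset.sum_congr rfl fun n _ => by simp [f]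
  rw [deriv_besselE, hEr, hEr', ← Complex.ofReal_div] at hlim
  simp only [hsum] at hlim
  refine ⟨r' / r, ?_, ?_⟩
  · rw [hasSum_iff_tendsto_nat_of_nonneg (fun n => by have := hlpos n; positivity)]
    exact (Complex.continuous_re.tendsto _).comp hlim
  · rw [hEr, hEr']; push_cast
    have : (r : ℂ) ≠ 0 := by exact_mod_cast hr.ne'
    field_simp

/-- The partial fraction series at y = 0 has terms 4/j_n². -/
lemma summable_inv_besselJZero_sq : Summable fun n : ℕ => 1 / besselJZero ν (n + 1) ^ 2 := by
  obtain ⟨T, hT, -⟩ := exists_hasSum_inv hν le_rfl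
  refine (hT.summable.mul_left (1 / 4)).congr fun n => ?_
  have := besselJZero_pos hν n
  field_simp
  ring

/-- Partial fraction expansion of `I_{ν-1} / I_ν`. -/
lemma exists_hasSum_besselI_div {x : ℝ} (hx : 0 < x) : ∃ T : ℝ,
    HasSum (fun n : ℕ => 2 * x / (x ^ 2 + besselJZero ν (n + 1) ^ 2)) T ∧
      besselI (ν - 1) x / besselI ν x = 2 * ν / x + T := by
  obtain ⟨T, hT, hE⟩ := exists_hasSum_inv hν (y := x ^ 2 / 4) (by positivity)
  refine ⟨x / 2 * T, (hT.mul_left (x / 2)).congr_fun fun n => ?_, ?_⟩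
  · have := besselJZero_pos hν n
    field_simp
    ring
  · have hx' : (x : ℂ) ≠ 0 := by exact_mod_cast hx.ne'
    have h0 := besselE_ne_zero_of_nonneg hν (x := x ^ 2 / 4) (by positivity)
    -- The recurrence E_{ν-1} = ν E_ν + w E_{ν+1} at w = x²/4 splits the quotient into 2ν/x and the
    -- logarithmic derivative.
    have hrec := besselE_eq_add (ν - 1) ((x : ℂ) ^ 2 / 4)
    rw [show (ν : ℂ) - 1 + 1 = ν by ring, show (ν : ℂ) - 1 + 2 = ν + 1 by ring] at hrec
    push_cast at hE h0 ⊢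
    rw [besselI_sub_one_div hx', hrec, hE]
    field_simp
    ring

end zeros

/-! ### Double series over a positive sequence with summable inverse squares -/

lemma sum_Icc_mul_pow (A B : ℝ) (N : ℕ) :
    (∑ k ∈ Finset.Icc 1 N, A ^ (N + 1 - k) * B ^ k) * (A - B) = A * B * (A ^ N - B ^ N) := by
  have h1 : ∑ k ∈ Finset.Icc 1 N, A ^ (N + 1 - k) * B ^ k
      = A * B * ∑ i ∈ Finset.range N, A ^ i * B ^ (N - 1 - i) := by
    rw [← Finset.sum_range_reflect, Finset.mul_sum]
    rw [← Finset.Ico_succ_right_eq_Icc, Finset.sum_Ico_eq_sum_range]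
    simp only [Nat.succ_eq_succ, Nat.succ_eq_add_one, Nat.add_sub_cancel]
    refine Finset.sum_congr rfl fun i hi => ?_
    have hi' := Finset.mem_range.mp hi
    rw [show N + 1 - (1 + i) = (N - 1 - i) + 1 by omega, show N - 1 - (N - 1 - i) = i by omega]
    ring
  rw [h1, mul_assoc, geom_sum₂_mul]

section sequence

variable {j : ℕ → ℝ} (hj : ∀ n, 0 < j n) (hs : Summable fun n => 1 / j n ^ 2)

include hj hs

/-- Each 1/j_n² is at most the full sum, so the higher powers are dominated by a constant multiple
of 1/j_n². -/
lemma summable_inv_pow {k : ℕ} (hk : 1 ≤ k) : Summable fun n => 1 / j n ^ (2 * k) := by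
  obtain ⟨k, rfl⟩ := Nat.exists_eq_add_of_le' hk
  refine .of_nonneg_of_le (fun n => by have := hj n; positivity) (fun n => ?_)
    (hs.mul_left ((∑' n, 1 / j n ^ 2) ^ k))
  have h1 : 1 / j n ^ 2 ≤ ∑' n, 1 / j n ^ 2 :=
    hs.le_tsum n fun m _ => by have := hj m; positivity
  have h2 : 1 / j n ^ (2 * (k + 1)) = (1 / j n ^ 2) ^ k * (1 / j n ^ 2) := by
    rw [← pow_succ, one_div_pow, ← pow_mul]
  rw [h2]
  have := hj n
  gcongr

/-- Dropping β j_p² from the denominator leaves a product of two convergent series. -/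
lemma summable_double {α β : ℝ} (hα : 0 < α) (hβ : 0 < β) {N : ℕ} (hN : 1 ≤ N) :
    Summable fun p : ℕ × ℕ => 1 / (j p.1 ^ (2 * N) * (β * j p.1 ^ 2 + α * j p.2 ^ 2)) := by
  have h := (summable_inv_pow hj hs hN).mul_of_nonneg (hs.mul_left (1 / α))
    (fun n => by have := hj n; simp only [Pi.zero_apply]; positivity)
    (fun n => by have := hj n; simp only [Pi.zero_apply]; positivity)
  refine .of_nonneg_of_le (fun p => ?_) (fun p => ?_) h
  · have := hj p.1; have := hj p.2; positivity
  · have h1 := hj p.1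
    have h2 := hj p.2
    rw [← one_div_mul_one_div, one_div_mul_one_div α]
    gcongr
    have : 0 < β * j p.1 ^ 2 := by positivity
    linarith

/-- The weighted sum of the partial fraction expansion over all zeros. -/
lemma hasSum_weighted (ν : ℝ) {α β r : ℝ} (hα : 0 < α) (hβ : 0 < β) (hr : 0 < r)
    (hrαβ : r ^ 2 * α = β) {N : ℕ} (hN : 1 ≤ N) :
    HasSum (fun q => 1 / j q ^ (2 * N + 1) *
        (2 * ν / (r * j q) + ∑' n, 2 * (r * j q) / ((r * j q) ^ 2 + j n ^ 2)))
      (2 * ν / r * ∑' n, 1 / j n ^ (2 * (N + 1)) +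
        2 * r * α * ∑' p : ℕ × ℕ, 1 / (j p.1 ^ (2 * N) * (β * j p.1 ^ 2 + α * j p.2 ^ 2))) := by
  have hD := summable_double hj hs hα hβ hN
  have hZ := summable_inv_pow hj hs (k := N + 1) (by omega)
  have hfib : ∀ q, HasSum (fun n => 1 / (j q ^ (2 * N) * (β * j q ^ 2 + α * j n ^ 2)))
      (∑' n, 1 / (j q ^ (2 * N) * (β * j q ^ 2 + α * j n ^ 2))) := fun q =>
    (hD.prod_factor q).hasSum
  refine ((hZ.hasSum.mul_left (2 * ν / r)).add
    ((hD.hasSum.prod_fiberwise hfib).mul_left (2 * r * α))).congr_fun fun q => ?_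
  have hq := hj q
  rw [mul_add, ← tsum_mul_left, ← tsum_mul_left]
  congr 1
  · field_simp
    ring
  · refine tsum_congr fun n => ?_
    have hn := hj n
    rw [← hrαβ]
    field_simp
    ring

/-- The convolution of power sums as a double series. -/
lemma sum_convolution {α β : ℝ} (hα : 0 < α) (hβ : 0 < β) {N : ℕ} (hN : 1 ≤ N) :
    ∑ k ∈ Finset.Icc 1 N, (-1) ^ k * α ^ (N - k + 1) * β ^ k *
        (∑' n, 1 / j n ^ (2 * k)) * (∑' n, 1 / j n ^ (2 * (N + 1 - k)))
      = -(α ^ (N + 1) * β *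
          ∑' p : ℕ × ℕ, 1 / (j p.1 ^ (2 * N) * (β * j p.1 ^ 2 + α * j p.2 ^ 2)))
        - (-β) ^ (N + 1) * α *
          ∑' p : ℕ × ℕ, 1 / (j p.1 ^ (2 * N) * (α * j p.1 ^ 2 + β * j p.2 ^ 2)) := by
  have h1 : HasSum (fun p : ℕ × ℕ => ∑ k ∈ Finset.Icc 1 N, (-1) ^ k * α ^ (N - k + 1) * β ^ k *
        (1 / j p.2 ^ (2 * k) * (1 / j p.1 ^ (2 * (N + 1 - k)))))
      (∑ k ∈ Finset.Icc 1 N, (-1) ^ k * α ^ (N - k + 1) * β ^ k *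
        (∑' n, 1 / j n ^ (2 * k)) * (∑' n, 1 / j n ^ (2 * (N + 1 - k)))) := by
    refine hasSum_sum fun k hk => ?_
    obtain ⟨hk1, hk2⟩ := Finset.mem_Icc.mp hk
    have ha := summable_inv_pow hj hs hk1
    have hb := summable_inv_pow hj hs (k := N + 1 - k) (by omega)
    have hab := hb.hasSum.mul ha.hasSum (hb.mul_of_nonneg ha
      (fun n => by have := hj n; simp only [Pi.zero_apply]; positivity)
      (fun n => by have := hj n; simp only [Pi.zero_apply]; positivity))
    have := hab.mul_left ((-1) ^ k * α ^ (N - k + 1) * β ^ k)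
    rw [mul_comm (∑' n, 1 / j n ^ (2 * (N + 1 - k))), ← mul_assoc] at this
    exact this.congr_fun fun p => by ring
  have h2 := (summable_double hj hs hα hβ hN).hasSum.mul_left (α ^ (N + 1) * β)
  -- The second double series is transposed so that both have the same denominator β j_p² + α j_n²
  -- at the same index pair.
  have h3 := ((Equiv.prodComm ℕ ℕ).hasSum_iff.mpr
    (summable_double hj hs hβ hα hN).hasSum).mul_left ((-β) ^ (N + 1) * α)
  refine h1.unique ((h2.neg.sub h3).congr_fun fun p => ?_)
  have hp1 := hj p.1
  have hp2 := hj p.2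
  -- With the sign placed in B, the alternating sum over k is geometric, and A - B is a sum of
  -- positive terms.
  set A := α / j p.1 ^ 2 with hA
  set B := -β / j p.2 ^ 2 with hB
  have hAB : 0 < A - B := by
    have : A - B = α / j p.1 ^ 2 + β / j p.2 ^ 2 := by rw [hA, hB]; ring
    rw [this]; positivity
  have hsum : ∑ k ∈ Finset.Icc 1 N, (-1) ^ k * α ^ (N - k + 1) * β ^ k *
        (1 / j p.2 ^ (2 * k) * (1 / j p.1 ^ (2 * (N + 1 - k))))
      = ∑ k ∈ Finset.Icc 1 N, A ^ (N + 1 - k) * B ^ k := by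
    refine Finset.sum_congr rfl fun k hk => ?_
    obtain ⟨hk1, hk2⟩ := Finset.mem_Icc.mp hk
    rw [hA, hB, div_pow, div_pow, ← pow_mul, ← pow_mul, neg_pow β,
      show N + 1 - k = N - k + 1 by omega]
    ring
  rw [hsum, eq_div_of_mul_eq hAB.ne' (sum_Icc_mul_pow A B N)]
  have e : A - B = (β * j p.1 ^ 2 + α * j p.2 ^ 2) / (j p.1 ^ 2 * j p.2 ^ 2) := by
    rw [hA, hB]; field_simp; ring
  have e2 : α * j p.2 ^ 2 + β * j p.1 ^ 2 = β * j p.1 ^ 2 + α * j p.2 ^ 2 := add_comm _ _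
  have hden : 0 < β * j p.1 ^ 2 + α * j p.2 ^ 2 := by positivity
  simp only [Function.comp, Equiv.prodComm_apply, Prod.fst_swap, Prod.snd_swap]
  rw [e, e2, hA, hB, div_pow, div_pow, ← pow_mul, ← pow_mul]
  field_simp
  ring

end sequence

/-! ### The convolution identity for general ν > -1 -/

section main

variable {ν : ℝ} (hν : -1 < ν)

lemma besselZeta_eq (ν : ℝ) (k : ℕ) :
    besselZeta ν k = ((∑' n : ℕ, 1 / besselJZero ν (n + 1) ^ (2 * k) : ℝ) : ℂ) := by
  rw [besselZeta, Complex.ofReal_tsum]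
  refine tsum_congr fun n => ?_
  rw [show (2 * (k : ℂ)) = ((2 * k : ℕ) : ℂ) by push_cast; ring, Complex.cpow_natCast]
  push_cast; rfl

include hν

lemma summable_besselZeta {k : ℕ} (hk : 1 ≤ k) :
    Summable fun n : ℕ => 1 / (besselJZero ν (n + 1) : ℂ) ^ (2 * (k : ℂ)) := by
  refine (Complex.summable_ofReal.mpr (summable_inv_pow (besselJZero_pos hν)
    (summable_inv_besselJZero_sq hν) hk)).congr fun n => ?_
  rw [show (2 * (k : ℂ)) = ((2 * k : ℕ) : ℂ) by push_cast; ring, Complex.cpow_natCast]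
  push_cast; rfl

lemma hasSum_besselI_series {α β : ℝ} (hα : 0 < α) (hβ : 0 < β) {N : ℕ} (hN : 1 ≤ N) :
    HasSum (fun q : ℕ => 1 / (besselJZero ν (q + 1) : ℂ) ^ (2 * N + 1) *
          (besselI (ν - 1) (√(β / α) * besselJZero ν (q + 1)) /
            besselI ν (√(β / α) * besselJZero ν (q + 1))))
      ((2 * ν / √(β / α) * ∑' n, 1 / besselJZero ν (n + 1) ^ (2 * (N + 1)) +
        2 * √(β / α) * α * ∑' p : ℕ × ℕ, 1 / (besselJZero ν (p.1 + 1) ^ (2 * N) *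
          (β * besselJZero ν (p.1 + 1) ^ 2 + α * besselJZero ν (p.2 + 1) ^ 2)) : ℝ) : ℂ) := by
  have hr : 0 < √(β / α) := Real.sqrt_pos.mpr (by positivity)
  have hr2 : √(β / α) ^ 2 * α = β := by
    rw [Real.sq_sqrt (by positivity)]; field_simp
  have h := Complex.hasSum_ofReal.mpr (hasSum_weighted (besselJZero_pos hν)
    (summable_inv_besselJZero_sq hν) ν hα hβ hr hr2 hN)
  refine h.congr_fun fun q => ?_
  have hq := besselJZero_pos hν q
  obtain ⟨T, hT, hI⟩ := exists_hasSum_besselI_div hν (mul_pos hr hq)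
  rw [hT.tsum_eq]
  push_cast at hI ⊢
  rw [hI]

lemma besselZeta_convolution {α β : ℝ} (hα : 0 < α) (hβ : 0 < β) {N : ℕ} (hN : 1 ≤ N) :
    ∑ k ∈ Finset.Icc 1 N, (-1 : ℂ) ^ k * (α : ℂ) ^ (N - k + 1) * (β : ℂ) ^ k *
            besselZeta ν k * besselZeta ν ((N : ℂ) + 1 - k)
          = (ν : ℂ) * ((α : ℂ) ^ (N + 1) + (-β : ℂ) ^ (N + 1)) * besselZeta ν ((N : ℂ) + 1)
            - (α : ℂ) ^ (N + 1) / 2 * √(β / α) *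
              ∑' q : ℕ, 1 / (besselJZero ν (q + 1) : ℂ) ^ (2 * N + 1) *
                (besselI (ν - 1) (√(β / α) * besselJZero ν (q + 1)) /
                  besselI ν (√(β / α) * besselJZero ν (q + 1)))
            - (-β : ℂ) ^ (N + 1) / 2 * √(α / β) *
              ∑' q : ℕ, 1 / (besselJZero ν (q + 1) : ℂ) ^ (2 * N + 1) *
                (besselI (ν - 1) (√(α / β) * besselJZero ν (q + 1)) /
                  besselI ν (√(α / β) * besselJZero ν (q + 1))) := by
  rw [(hasSum_besselI_series hν hα hβ hN).tsum_eq, (hasSum_besselI_series hν hβ hα hN).tsum_eq,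
    show (N : ℂ) + 1 = ((N + 1 : ℕ) : ℂ) by push_cast; ring, besselZeta_eq]
  have hconv := sum_convolution (besselJZero_pos hν) (summable_inv_besselJZero_sq hν) hα hβ hN
  have hL : ∑ k ∈ Finset.Icc 1 N, (-1 : ℂ) ^ k * (α : ℂ) ^ (N - k + 1) * (β : ℂ) ^ k *
            besselZeta ν k * besselZeta ν (((N + 1 : ℕ) : ℂ) - k)
      = ((∑ k ∈ Finset.Icc 1 N, (-1) ^ k * α ^ (N - k + 1) * β ^ k *
        (∑' n : ℕ, 1 / besselJZero ν (n + 1) ^ (2 * k)) *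
        (∑' n : ℕ, 1 / besselJZero ν (n + 1) ^ (2 * (N + 1 - k))) : ℝ) : ℂ) := by
    rw [Complex.ofReal_sum]
    refine Finset.sum_congr rfl fun k hk => ?_
    obtain ⟨hk1, hk2⟩ := Finset.mem_Icc.mp hk
    rw [← Nat.cast_sub (by omega : k ≤ N + 1), besselZeta_eq, besselZeta_eq]
    simp only [Complex.ofReal_mul, Complex.ofReal_pow, Complex.ofReal_neg, Complex.ofReal_one]
  rw [hL, hconv]
  have hr1 : 0 < √(β / α) := Real.sqrt_pos.mpr (by positivity)
  have hr2 : 0 < √(α / β) := Real.sqrt_pos.mpr (by positivity)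
  have e1 : √(β / α) ^ 2 * α = β := by
    rw [Real.sq_sqrt (by positivity)]; field_simp
  have e2 : √(α / β) ^ 2 * β = α := by
    rw [Real.sq_sqrt (by positivity)]; field_simp
  generalize √(β / α) = r1 at *
  generalize √(α / β) = r2 at *
  generalize (∑' n : ℕ, 1 / besselJZero ν (n + 1) ^ (2 * (N + 1))) = Z
  generalize (∑' p : ℕ × ℕ, 1 / (besselJZero ν (p.1 + 1) ^ (2 * N) *
          (β * besselJZero ν (p.1 + 1) ^ 2 + α * besselJZero ν (p.2 + 1) ^ 2))) = D1
  generalize (∑' p : ℕ × ℕ, 1 / (besselJZero ν (p.1 + 1) ^ (2 * N) *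
          (α * besselJZero ν (p.1 + 1) ^ 2 + β * besselJZero ν (p.2 + 1) ^ 2))) = D2
  -- Since r₁²α = β and r₂²β = α, the weighted series times r₁, r₂ are 2νZ + 2βD₁ and 2νZ + 2αD₂;
  -- their Z-parts cancel the term ν(α^{N+1} + (-β)^{N+1})Z.
  have key : -(α ^ (N + 1) * β * D1) - (-β) ^ (N + 1) * α * D2
      = ν * (α ^ (N + 1) + (-β) ^ (N + 1)) * Z
        - α ^ (N + 1) / 2 * r1 * (2 * ν / r1 * Z + 2 * r1 * α * D1)
        - (-β) ^ (N + 1) / 2 * r2 * (2 * ν / r2 * Z + 2 * r2 * β * D2) := by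
    have h1 : r1 * (2 * ν / r1 * Z + 2 * r1 * α * D1) = 2 * ν * Z + 2 * β * D1 := by
      rw [← e1]; field_simp
    have h2 : r2 * (2 * ν / r2 * Z + 2 * r2 * β * D2) = 2 * ν * Z + 2 * α * D2 := by
      rw [← e2]; field_simp
    rw [mul_assoc (α ^ (N + 1) / 2), mul_assoc ((-β) ^ (N + 1) / 2), h1, h2]
    ring
  have := congrArg Complex.ofReal key
  push_cast at this ⊢
  exact this

end main

/-! ### Half-integer orders: elementary formulas, zeros and zeta values -/

lemma sqrt_pi_ne_zero : ((√Real.pi : ℝ) : ℂ) ≠ 0 := by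
  exact_mod_cast (Real.sqrt_pos.mpr Real.pi_pos).ne'

lemma besselE_neg_half (z : ℂ) : besselE (-1 / 2) (z ^ 2 / 4) = Complex.cosh z / √Real.pi := by
  have hpi := sqrt_pi_ne_zero
  refine (hasSum_besselE (-1 / 2) (z ^ 2 / 4)).unique
    (((Complex.hasSum_cosh z).div_const ((√Real.pi : ℝ) : ℂ)).congr_fun fun m => ?_)
  -- Duplication at m + 1/2, that is 4^m m! Γ(m+1/2) = (2m)! √π, turns the coefficients into those
  -- of cosh.
  have h1 := Complex.Gamma_mul_Gamma_add_half ((m : ℂ) + 1 / 2)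
  have h2 : (2 : ℂ) ^ (1 - 2 * ((m : ℂ) + 1 / 2)) = ((4 : ℂ) ^ m)⁻¹ := by
    rw [show 1 - 2 * ((m : ℂ) + 1 / 2) = -((2 * m : ℕ) : ℂ) by push_cast; ring,
      Complex.cpow_neg, Complex.cpow_natCast, pow_mul]
    norm_num
  rw [h2, show (m : ℂ) + 1 / 2 + 1 / 2 = m + 1 by ring,
    show 2 * ((m : ℂ) + 1 / 2) = ((2 * m : ℕ) : ℂ) + 1 by push_cast; ring,
    Complex.Gamma_nat_eq_factorial, Complex.Gamma_nat_eq_factorial] at h1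
  have h3 : Complex.Gamma ((m : ℂ) + 1 / 2) ≠ 0 :=
    Complex.Gamma_ne_zero_of_re_pos (by simp; positivity)
  have h4 : (m ! : ℂ) ≠ 0 := by exact_mod_cast Nat.factorial_ne_zero m
  have h5 : ((2 * m)! : ℂ) ≠ 0 := by exact_mod_cast Nat.factorial_ne_zero _
  rw [besselCoeff, show (m : ℂ) + -1 / 2 + 1 = m + 1 / 2 by ring, div_pow, ← pow_mul]
  have h6 : (4 : ℂ) ^ m ≠ 0 := pow_ne_zero _ (by norm_num)
  have h7 : Complex.Gamma ((m : ℂ) + 1 / 2) * (m ! : ℂ) * 4 ^ m = ((2 * m)! : ℂ) * √Real.pi := by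
    rw [h1]; field_simp
  rw [div_div, ← h7]
  field_simp

/-- Obtained by differentiating the cosh formula in z. The factor z is kept on the left so that z =
0 needs no separate treatment. -/
lemma mul_besselE_half (z : ℂ) :
    z * besselE (1 / 2) (z ^ 2 / 4) = 2 * Complex.sinh z / √Real.pi := by
  have h1 : HasDerivAt (fun z : ℂ => besselE (-1 / 2) (z ^ 2 / 4))
      (besselE (-1 / 2 + 1) (z ^ 2 / 4) * (2 * z / 4)) z := by
    have h := ((hasDerivAt_pow 2 z).div_const 4)
    refine ((hasDerivAt_besselE (-1 / 2) (z ^ 2 / 4)).comp z h).congr_deriv ?_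
    norm_num
  have h2 := (Complex.hasDerivAt_cosh z).div_const ((√Real.pi : ℝ) : ℂ)
  rw [funext besselE_neg_half] at h1
  have h3 := h1.unique h2
  rw [show (-1 / 2 + 1 : ℂ) = 1 / 2 by norm_num] at h3
  linear_combination 2 * h3

lemma sq_mul_besselE_three_halves (z : ℂ) : z ^ 2 / 4 * besselE (3 / 2) (z ^ 2 / 4)
    = besselE (-1 / 2) (z ^ 2 / 4) - 1 / 2 * besselE (1 / 2) (z ^ 2 / 4) := by
  have h := besselE_eq_add (-1 / 2) (z ^ 2 / 4)
  rw [show (-1 / 2 + 1 : ℂ) = 1 / 2 by norm_num, show (-1 / 2 + 2 : ℂ) = 3 / 2 by norm_num] at h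
  linear_combination -h

lemma besselE_neg_three_halves (z : ℂ) : besselE (-3 / 2) (z ^ 2 / 4)
    = (z * Complex.sinh z - Complex.cosh z) / (2 * √Real.pi) := by
  have h := besselE_eq_add (-3 / 2) (z ^ 2 / 4)
  rw [show (-3 / 2 + 1 : ℂ) = -1 / 2 by norm_num, show (-3 / 2 + 2 : ℂ) = 1 / 2 by norm_num,
    besselE_neg_half] at h
  have h2 := mul_besselE_half z
  rw [h]
  have hpi := sqrt_pi_ne_zero
  field_simp at h2 ⊢
  linear_combination 2 * z * h2

lemma neg_sq_div_four (x : ℂ) : -(x ^ 2 / 4) = (x * Complex.I) ^ 2 / 4 := by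
  rw [mul_pow, Complex.I_sq]; ring

lemma besselE_neg_half_neg (x : ℂ) :
    besselE (-1 / 2) (-(x ^ 2 / 4)) = Complex.cos x / √Real.pi := by
  rw [neg_sq_div_four, besselE_neg_half, Complex.cosh_mul_I]

lemma mul_besselE_half_neg (x : ℂ) :
    x * besselE (1 / 2) (-(x ^ 2 / 4)) = 2 * Complex.sin x / √Real.pi := by
  have h := mul_besselE_half (x * Complex.I)
  rw [Complex.sinh_mul_I, ← neg_sq_div_four] at h
  have h2 : Complex.I * (x * besselE (1 / 2) (-(x ^ 2 / 4)))
      = Complex.I * (2 * Complex.sin x / √Real.pi) := by linear_combination h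
  exact mul_left_cancel₀ Complex.I_ne_zero h2

/-- Principal powers are not multiplicative in general; here no branch is crossed because 2 is a
positive real. -/
lemma half_cpow_mul_two_cpow {z : ℂ} (hz : z ≠ 0) (a : ℂ) : (z / 2) ^ a * 2 ^ a = z ^ a := by
  have h2 : z / 2 ≠ 0 := by simpa using hz
  have h := Complex.log_ofReal_mul (r := 2) two_pos h2
  rw [show ((2 : ℝ) : ℂ) * (z / 2) = z by push_cast; field_simp, Complex.ofReal_log (by norm_num)] at h
  rw [Complex.cpow_def_of_ne_zero h2, Complex.cpow_def_of_ne_zero two_ne_zero,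
    Complex.cpow_def_of_ne_zero hz, ← Complex.exp_add, h]
  congr 1; push_cast; ring

lemma two_cpow_half : (2 : ℂ) ^ (1 / 2 : ℂ) = (√2 : ℝ) := by
  rw [Real.sqrt_eq_rpow, Complex.ofReal_cpow (by norm_num)]
  push_cast; rfl

lemma besselI_neg_half_div {z : ℂ} (hz : Complex.sinh z ≠ 0) :
    besselI (-1 / 2) z / besselI (1 / 2) z = cothC z := by
  have hz0 : z ≠ 0 := by rintro rfl; simp at hz
  have h := besselI_sub_one_div hz0 (1 / 2)
  rw [show (1 / 2 - 1 : ℂ) = -1 / 2 by norm_num, besselE_neg_half,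
    eq_div_of_mul_eq hz0 ((mul_comm _ _).trans (mul_besselE_half z))] at h
  rw [h, cothC]
  have := sqrt_pi_ne_zero
  field_simp

/-- Where z coth z = 1, the denominators on both sides vanish and the identity reads 0 = 0. -/
lemma besselI_half_div {z : ℂ} (hz : Complex.sinh z ≠ 0) :
    besselI (1 / 2) z / besselI (3 / 2) z = z / (z * cothC z - 1) := by
  have hz0 : z ≠ 0 := by rintro rfl; simp at hz
  have h := besselI_sub_one_div hz0 (3 / 2)
  have h3 := sq_mul_besselE_three_halves z
  have hpi := sqrt_pi_ne_zero
  have e1 := eq_div_of_mul_eq hz0 ((mul_comm _ _).trans (mul_besselE_half z))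
  have e3 : besselE (3 / 2) (z ^ 2 / 4)
      = 4 * Complex.sinh z / (z ^ 3 * √Real.pi) * (z * cothC z - 1) := by
    rw [besselE_neg_half, e1] at h3
    have : besselE (3 / 2) (z ^ 2 / 4) = 4 / z ^ 2 * (z ^ 2 / 4 * besselE (3 / 2) (z ^ 2 / 4)) := by
      field_simp
    rw [this, h3, cothC]
    field_simp
  rw [show (3 / 2 - 1 : ℂ) = 1 / 2 by norm_num, e1, e3] at h
  rw [h]
  field_simp
  norm_num

lemma besselI_neg_three_halves_div {z : ℂ} (hz0 : z ≠ 0) (hz : Complex.cosh z ≠ 0) :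
    besselI (-3 / 2) z / besselI (-1 / 2) z = Complex.tanh z - 1 / z := by
  have h := besselI_sub_one_div hz0 (-1 / 2)
  rw [show (-1 / 2 - 1 : ℂ) = -3 / 2 by norm_num, besselE_neg_half, besselE_neg_three_halves] at h
  rw [h, Complex.tanh_eq_sinh_div_cosh]
  have := sqrt_pi_ne_zero
  field_simp

lemma normalizedBesselJ_half {z : ℂ} (hz : z ≠ 0) :
    normalizedBesselJ (1 / 2) z = Complex.sin z / z := by
  have hg : Complex.Gamma (1 / 2 + 1) = √Real.pi / 2 := by
    rw [Complex.Gamma_add_one _ (by norm_num), Complex.Gamma_one_half_eq, Real.sqrt_eq_rpow,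
      Complex.ofReal_cpow Real.pi_pos.le]
    push_cast; ring
  have hc := half_cpow_mul_two_cpow hz (1 / 2)
  have hc0 : z ^ (1 / 2 : ℂ) ≠ 0 := by
    rw [Complex.cpow_def_of_ne_zero hz]; exact Complex.exp_ne_zero _
  have hE := eq_div_of_mul_eq hz ((mul_comm _ _).trans (mul_besselE_half_neg z))
  rw [normalizedBesselJ, besselJ_eq hz, hg, hE, div_eq_iff hc0, ← hc]
  have := sqrt_pi_ne_zero
  field_simp

lemma besselJ_neg_half {z : ℂ} (hz : z ≠ 0) :
    besselJ (-1 / 2) z = √(2 / Real.pi) * Complex.cos z / z ^ (1 / 2 : ℂ) := by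
  have hc := half_cpow_mul_two_cpow hz (1 / 2)
  have h2 := half_cpow_ne_zero hz (1 / 2)
  rw [besselJ_eq hz, besselE_neg_half_neg, ← hc, two_cpow_half, Real.sqrt_div (by norm_num),
    show (-1 / 2 : ℂ) = -(1 / 2) by norm_num, Complex.cpow_neg]
  have := sqrt_pi_ne_zero
  have h3 : ((√2 : ℝ) : ℂ) ≠ 0 := by exact_mod_cast (Real.sqrt_pos.mpr two_pos).ne'
  push_cast
  field_simp

lemma besselJZero_half (n : ℕ) : besselJZero (1 / 2) n = n * Real.pi := by
  have hpi := Real.pi_pos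
  refine congrFun (nthPositive_eq (f := fun n : ℕ => n * Real.pi) ?_ (by simp) ?_) n
  · intro m n hmn
    have : (m : ℝ) < n := by exact_mod_cast hmn
    simp only; gcongr
  · intro x hx
    have hx0 : (x : ℂ) ≠ 0 := by exact_mod_cast hx.ne'
    have hE := mul_besselE_half_neg x
    have h1 : besselJ ((1 / 2 : ℝ) : ℂ) x = 0 ↔ Real.sin x = 0 := by
      rw [besselJ_eq_zero_iff hx0]
      push_cast
      rw [eq_div_of_mul_eq hx0 ((mul_comm _ _).trans hE), ← Complex.ofReal_sin]
      simp [-Complex.ofReal_sin, hx.ne', (Real.sqrt_pos.mpr hpi).ne']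
    rw [Set.mem_ofPred_eq, h1, Real.sin_eq_zero_iff]
    constructor
    · rintro ⟨n, rfl⟩
      have hn : 0 < n := by
        have := (mul_pos_iff_of_pos_right hpi).mp hx
        exact_mod_cast this
      lift n to ℕ using hn.le
      exact ⟨n, by omega, by simp⟩
    · rintro ⟨n, -, rfl⟩
      exact ⟨n, by simp⟩

lemma besselJZero_neg_half_succ (n : ℕ) : besselJZero (-1 / 2) (n + 1) = Real.pi / 2 * (2 * n + 1) := by
  have hpi := Real.pi_pos
  -- The entry f 0 = 0 matches the convention `nthPositive S 0 = 0`; the zeros start at index 1.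
  let f : ℕ → ℝ := fun n => n.casesOn 0 fun n => Real.pi / 2 * (2 * n + 1)
  refine congrFun (nthPositive_eq (f := f) ?_ rfl ?_) (n + 1)
  · refine strictMono_nat_of_lt_succ fun n => ?_
    cases n with
    | zero => simp only [f]; positivity
    | succ n => simp only [f]; gcongr; simp
  · intro x hx
    have hx0 : (x : ℂ) ≠ 0 := by exact_mod_cast hx.ne'
    have h1 : besselJ ((-1 / 2 : ℝ) : ℂ) x = 0 ↔ Real.cos x = 0 := by
      rw [besselJ_eq_zero_iff hx0]
      push_cast
      rw [besselE_neg_half_neg, ← Complex.ofReal_cos]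
      simp [-Complex.ofReal_cos, (Real.sqrt_pos.mpr hpi).ne']
    rw [Set.mem_ofPred_eq, h1, Real.cos_eq_zero_iff]
    constructor
    · rintro ⟨n, rfl⟩
      have hn : 0 ≤ n := by
        have h2 : 0 < (2 * (n : ℝ) + 1) := by
          by_contra h; nlinarith
        have h3 : 0 < 2 * n + 1 := by exact_mod_cast h2
        omega
      lift n to ℕ using hn
      exact ⟨n + 1, by omega, by simp only [f]; push_cast; ring⟩
    · rintro ⟨n, hn, rfl⟩
      obtain ⟨n, rfl⟩ := Nat.exists_eq_add_of_le' hn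
      exact ⟨n, by simp only [f]; push_cast; ring⟩

lemma besselJZero_three_halves (n : ℕ) : besselJZero (3 / 2) n = tanRoot n := by
  refine (nthPositive_congr (fun x hx => ?_) n).1
  have hx0 : (x : ℂ) ≠ 0 := by exact_mod_cast hx.ne'
  have hpi := sqrt_pi_ne_zero
  have h3 := sq_mul_besselE_three_halves (x * Complex.I)
  rw [← neg_sq_div_four, besselE_neg_half_neg,
    eq_div_of_mul_eq hx0 ((mul_comm _ _).trans (mul_besselE_half_neg x))] at h3
  have h4 : x ^ 3 * √Real.pi * besselE (3 / 2) (-((x : ℂ) ^ 2 / 4))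
      = 4 * ((Real.sin x - x * Real.cos x : ℝ) : ℂ) := by
    push_cast
    field_simp at h3
    linear_combination -h3
  have h1 : besselJ ((3 / 2 : ℝ) : ℂ) x = 0 ↔ Real.sin x - x * Real.cos x = 0 := by
    rw [besselJ_eq_zero_iff hx0]
    push_cast
    rw [← mul_right_inj' (mul_ne_zero (pow_ne_zero 3 hx0) hpi), h4, mul_zero]
    rw [mul_eq_zero, or_iff_right (by norm_num), Complex.ofReal_eq_zero]
  rw [Set.mem_ofPred_eq, Set.mem_ofPred_eq, h1, Real.tan_eq_sin_div_cos]
  -- At a pole `Real.tan` is 0, which is not x > 0, and sin x - x cos x = sin x is nonzero there, so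
  -- both conditions fail.
  by_cases hc : Real.cos x = 0
  · have hs := Real.sin_sq_add_cos_sq x
    rw [hc] at hs ⊢
    simp only [mul_zero, sub_zero, div_zero]
    exact ⟨fun h => by simp [h] at hs, fun h => absurd h hx.ne⟩
  · rw [div_eq_iff hc, sub_eq_zero]

lemma besselZeta_half {k : ℕ} (hk : 1 ≤ k) :
    besselZeta (1 / 2) k = riemannZeta (2 * k) / (Real.pi : ℂ) ^ (2 * k) := by
  rw [besselZeta_eq, show (2 * (k : ℂ)) = ((2 * k : ℕ) : ℂ) by push_cast; ring,
    zeta_eq_tsum_one_div_nat_add_one_cpow (by simp; norm_cast; omega), ← tsum_div_const,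
    Complex.ofReal_tsum]
  refine tsum_congr fun n => ?_
  rw [Complex.cpow_natCast, besselJZero_half]
  push_cast
  rw [mul_pow, div_div]

lemma tsum_odd_pow {k : ℕ} (hk : 1 ≤ k) :
    ∑' n : ℕ, 1 / (2 * (n : ℂ) + 1) ^ (2 * k) = (1 - 1 / 2 ^ (2 * k)) * riemannZeta (2 * k) := by
  -- The term n = 0 is 1/0 = 0, so the sum may start at 0 and be split by parity.
  have hz : riemannZeta (2 * k) = ∑' n : ℕ, 1 / (n : ℂ) ^ (2 * k) := by
    rw [show (2 * (k : ℂ)) = ((2 * k : ℕ) : ℂ) by push_cast; ring,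
      zeta_nat_eq_tsum_of_gt_one (by omega)]
  have hs : Summable fun n : ℕ => 1 / (n : ℂ) ^ (2 * k) := by
    rw [← summable_norm_iff]
    simpa using Real.summable_nat_pow_inv.mpr (by omega : 1 < 2 * k)
  have h := tsum_even_add_odd (f := fun n : ℕ => 1 / (n : ℂ) ^ (2 * k))
    (hs.comp_injective (i := fun n : ℕ => 2 * n) fun a b h => by simpa using h)
    (hs.comp_injective (i := fun n : ℕ => 2 * n + 1) fun a b h => by simpa using h)
  have he : ∑' n : ℕ, 1 / ((2 * n : ℕ) : ℂ) ^ (2 * k)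
      = 1 / 2 ^ (2 * k) * ∑' n : ℕ, 1 / (n : ℂ) ^ (2 * k) := by
    rw [← tsum_mul_left]
    refine tsum_congr fun n => ?_
    push_cast
    rw [mul_pow, one_div_mul_one_div]
  simp only [he] at h
  push_cast at h
  rw [hz]
  linear_combination h

lemma besselZeta_neg_half {k : ℕ} (hk : 1 ≤ k) : besselZeta (-1 / 2) k
    = (2 ^ (2 * k) - 1) / (Real.pi : ℂ) ^ (2 * k) * riemannZeta (2 * k) := by
  have hpi : (Real.pi : ℂ) ≠ 0 := by exact_mod_cast Real.pi_ne_zero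
  have h : besselZeta (-1 / 2) k
      = 2 ^ (2 * k) / (Real.pi : ℂ) ^ (2 * k) * ∑' n : ℕ, 1 / (2 * (n : ℂ) + 1) ^ (2 * k) := by
    rw [besselZeta_eq, Complex.ofReal_tsum, ← tsum_mul_left]
    refine tsum_congr fun n => ?_
    rw [besselJZero_neg_half_succ]
    push_cast
    rw [mul_pow, div_pow]
    field_simp
  rw [h, tsum_odd_pow hk]
  field_simp

lemma sinh_ofReal_ne_zero {x : ℝ} (hx : 0 < x) : Complex.sinh x ≠ 0 := by
  rw [← Complex.ofReal_sinh]
  exact_mod_cast (Real.sinh_pos_iff.mpr hx).ne'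

lemma besselI_term_half {r : ℝ} (hr : 0 < r) (N q : ℕ) :
    1 / ((q : ℂ) + 1) ^ (2 * N + 1) * (r * cothC (Real.pi * ((q : ℂ) + 1) * r))
      = r * (Real.pi : ℂ) ^ (2 * N + 1) *
        (1 / (besselJZero (1 / 2) (q + 1) : ℂ) ^ (2 * N + 1) *
          (besselI (((1 / 2 : ℝ) : ℂ) - 1) (r * besselJZero (1 / 2) (q + 1)) /
            besselI ((1 / 2 : ℝ) : ℂ) (r * besselJZero (1 / 2) (q + 1)))) := by
  have hpi : (Real.pi : ℂ) ≠ 0 := by exact_mod_cast Real.pi_ne_zero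
  have hx : 0 < r * besselJZero (1 / 2) (q + 1) := mul_pos hr (besselJZero_pos (by norm_num) q)
  have h := besselI_neg_half_div (sinh_ofReal_ne_zero hx)
  rw [show (((1 / 2 : ℝ) : ℂ) - 1) = -1 / 2 by push_cast; norm_num,
    show ((1 / 2 : ℝ) : ℂ) = 1 / 2 by push_cast; rfl]
  rw [Complex.ofReal_mul] at h
  rw [h, besselJZero_half]
  push_cast
  rw [show (r : ℂ) * (((q : ℂ) + 1) * Real.pi) = Real.pi * ((q : ℂ) + 1) * r by ring, mul_pow]
  have : (q : ℂ) + 1 ≠ 0 := by exact_mod_cast Nat.succ_ne_zero q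
  field_simp

lemma besselI_term_three_halves {r : ℝ} (hr : 0 < r) (N q : ℕ) :
    1 / (tanRoot (q + 1) : ℂ) ^ (2 * N) *
        (1 / (r * tanRoot (q + 1) * cothC (r * tanRoot (q + 1)) - 1))
      = 1 / (r : ℂ) *
        (1 / (besselJZero (3 / 2) (q + 1) : ℂ) ^ (2 * N + 1) *
          (besselI (((3 / 2 : ℝ) : ℂ) - 1) (r * besselJZero (3 / 2) (q + 1)) /
            besselI ((3 / 2 : ℝ) : ℂ) (r * besselJZero (3 / 2) (q + 1)))) := by
  have hj := besselJZero_pos (ν := 3 / 2) (by norm_num) q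
  have h := besselI_half_div (sinh_ofReal_ne_zero (mul_pos hr hj))
  rw [show (((3 / 2 : ℝ) : ℂ) - 1) = 1 / 2 by push_cast; norm_num,
    show ((3 / 2 : ℝ) : ℂ) = 3 / 2 by push_cast; rfl]
  rw [Complex.ofReal_mul] at h
  rw [h, ← besselJZero_three_halves]
  have h1 : (r : ℂ) ≠ 0 := by exact_mod_cast hr.ne'
  have h2 : (besselJZero (3 / 2) (q + 1) : ℂ) ≠ 0 := by exact_mod_cast hj.ne'
  rw [pow_succ]
  field_simp

/-- The quotient is tanh z - 1/z; restoring 1/z at z = r j_q produces the extra term r⁻¹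
j_q^{-(2N+2)}, which sums to a zeta value. -/
lemma besselI_term_neg_half {r : ℝ} (hr : 0 < r) (N q : ℕ) :
    1 / (2 * (q : ℂ) + 1) ^ (2 * N + 1) * Complex.tanh (Real.pi / 2 * r * (2 * (q : ℂ) + 1))
      = ((Real.pi : ℂ) / 2) ^ (2 * N + 1) *
        (1 / (besselJZero (-1 / 2) (q + 1) : ℂ) ^ (2 * N + 1) *
          (besselI (((-1 / 2 : ℝ) : ℂ) - 1) (r * besselJZero (-1 / 2) (q + 1)) /
            besselI ((-1 / 2 : ℝ) : ℂ) (r * besselJZero (-1 / 2) (q + 1)))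
        + 1 / r * (1 / (besselJZero (-1 / 2) (q + 1) : ℂ) ^ (2 * ((N + 1 : ℕ) : ℂ)))) := by
  have hpi : (Real.pi : ℂ) ≠ 0 := by exact_mod_cast Real.pi_ne_zero
  have hj := besselJZero_pos (ν := -1 / 2) (by norm_num) q
  have hx := mul_pos hr hj
  have h1 : (r : ℂ) ≠ 0 := by exact_mod_cast hr.ne'
  have hq : 2 * (q : ℂ) + 1 ≠ 0 := by exact_mod_cast Nat.succ_ne_zero (2 * q)
  have h := besselI_neg_three_halves_div (z := ((r * besselJZero (-1 / 2) (q + 1) : ℝ) : ℂ))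
    (by exact_mod_cast hx.ne') (by
      rw [← Complex.ofReal_cosh]; exact_mod_cast (Real.cosh_pos _).ne')
  rw [show (((-1 / 2 : ℝ) : ℂ) - 1) = -3 / 2 by push_cast; norm_num,
    show ((-1 / 2 : ℝ) : ℂ) = -1 / 2 by push_cast; rfl]
  rw [Complex.ofReal_mul] at h
  rw [h, besselJZero_neg_half_succ,
    show (2 * ((N + 1 : ℕ) : ℂ)) = ((2 * N + 1 + 1 : ℕ) : ℂ) by push_cast; ring,
    Complex.cpow_natCast]
  push_cast
  rw [show (r : ℂ) * (Real.pi / 2 * (2 * (q : ℂ) + 1)) = Real.pi / 2 * r * (2 * (q : ℂ) + 1) by ring,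
    pow_succ _ (2 * N + 1), mul_pow]
  field_simp
  ring

/-! ### The identities for ν = 1/2, 3/2 and -1/2 -/

section special

variable {α β : ℝ} (hα : 0 < α) (hβ : 0 < β) {N : ℕ} (hN : 1 ≤ N)

include hα hβ hN

lemma hasSum_coth : HasSum (fun n : ℕ => 1 / ((n : ℂ) + 1) ^ (2 * N + 1) *
          (√(β / α) * cothC (Real.pi * ((n : ℂ) + 1) * √(β / α))))
      (√(β / α) * (Real.pi : ℂ) ^ (2 * N + 1) *
        ∑' q : ℕ, 1 / (besselJZero (1 / 2) (q + 1) : ℂ) ^ (2 * N + 1) *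
          (besselI (((1 / 2 : ℝ) : ℂ) - 1) (√(β / α) * besselJZero (1 / 2) (q + 1)) /
            besselI ((1 / 2 : ℝ) : ℂ) (√(β / α) * besselJZero (1 / 2) (q + 1)))) :=
  ((hasSum_besselI_series (ν := 1 / 2) (by norm_num) hα hβ hN).summable.hasSum.mul_left _).congr_fun
    fun q => besselI_term_half (Real.sqrt_pos.mpr (by positivity)) N q

lemma hasSum_tanRoot : HasSum (fun n : ℕ => 1 / (tanRoot (n + 1) : ℂ) ^ (2 * N) *
          (1 / (√(β / α) * tanRoot (n + 1) * cothC (√(β / α) * tanRoot (n + 1)) - 1)))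
      (1 / (√(β / α) : ℂ) *
        ∑' q : ℕ, 1 / (besselJZero (3 / 2) (q + 1) : ℂ) ^ (2 * N + 1) *
          (besselI (((3 / 2 : ℝ) : ℂ) - 1) (√(β / α) * besselJZero (3 / 2) (q + 1)) /
            besselI ((3 / 2 : ℝ) : ℂ) (√(β / α) * besselJZero (3 / 2) (q + 1)))) :=
  ((hasSum_besselI_series (ν := 3 / 2) (by norm_num) hα hβ hN).summable.hasSum.mul_left _).congr_fun
    fun q => besselI_term_three_halves (Real.sqrt_pos.mpr (by positivity)) N q

lemma hasSum_tanh : HasSum (fun q : ℕ => 1 / (2 * (q : ℂ) + 1) ^ (2 * N + 1) *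
          Complex.tanh (Real.pi / 2 * √(β / α) * (2 * (q : ℂ) + 1)))
      (((Real.pi : ℂ) / 2) ^ (2 * N + 1) *
        (∑' q : ℕ, 1 / (besselJZero (-1 / 2) (q + 1) : ℂ) ^ (2 * N + 1) *
          (besselI (((-1 / 2 : ℝ) : ℂ) - 1) (√(β / α) * besselJZero (-1 / 2) (q + 1)) /
            besselI ((-1 / 2 : ℝ) : ℂ) (√(β / α) * besselJZero (-1 / 2) (q + 1)))
        + 1 / (√(β / α) : ℂ) * besselZeta (-1 / 2) ((N + 1 : ℕ) : ℂ))) :=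
  (((hasSum_besselI_series (ν := -1 / 2) (by norm_num) hα hβ hN).summable.hasSum.add
    ((summable_besselZeta (ν := -1 / 2) (by norm_num) (k := N + 1)
      (by omega)).hasSum.mul_left _)).mul_left _).congr_fun
    fun q => besselI_term_neg_half (Real.sqrt_pos.mpr (by positivity)) N q

lemma zeta_convolution_coth :
    ∑ k ∈ Finset.Icc 1 N, (-β : ℂ) ^ k * (α : ℂ) ^ (N + 1 - k) *
            riemannZeta (2 * k) * riemannZeta (2 * N + 2 - 2 * k)
          = ((α : ℂ) ^ (N + 1) + (-β : ℂ) ^ (N + 1)) / 2 * riemannZeta (2 * N + 2)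
            - (α : ℂ) ^ (N + 1) * Real.pi / 2 *
              ∑' n : ℕ, 1 / ((n : ℂ) + 1) ^ (2 * N + 1) *
                (√(β / α) * cothC (Real.pi * ((n : ℂ) + 1) * √(β / α)))
            - Real.pi * (-β : ℂ) ^ (N + 1) / 2 *
              ∑' n : ℕ, 1 / ((n : ℂ) + 1) ^ (2 * N + 1) *
                (√(α / β) * cothC (Real.pi * ((n : ℂ) + 1) * √(α / β))) := by
  have hpi : (Real.pi : ℂ) ≠ 0 := by exact_mod_cast Real.pi_ne_zero
  have h := besselZeta_convolution (ν := 1 / 2) (by norm_num) hα hβ hN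
  rw [(hasSum_coth hα hβ hN).tsum_eq, (hasSum_coth hβ hα hN).tsum_eq]
  generalize (∑' q : ℕ, 1 / (besselJZero (1 / 2) (q + 1) : ℂ) ^ (2 * N + 1) *
    (besselI (((1 / 2 : ℝ) : ℂ) - 1) (√(β / α) * besselJZero (1 / 2) (q + 1)) /
      besselI ((1 / 2 : ℝ) : ℂ) (√(β / α) * besselJZero (1 / 2) (q + 1)))) = S1 at *
  generalize (∑' q : ℕ, 1 / (besselJZero (1 / 2) (q + 1) : ℂ) ^ (2 * N + 1) *
    (besselI (((1 / 2 : ℝ) : ℂ) - 1) (√(α / β) * besselJZero (1 / 2) (q + 1)) /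
      besselI ((1 / 2 : ℝ) : ℂ) (√(α / β) * besselJZero (1 / 2) (q + 1)))) = S2 at *
  have hz : besselZeta (1 / 2) ((N : ℂ) + 1)
      = riemannZeta (2 * N + 2) / (Real.pi : ℂ) ^ (2 * (N + 1)) := by
    have := besselZeta_half (k := N + 1) (by omega)
    push_cast at this
    rw [this, show (2 * ((N : ℂ) + 1)) = 2 * N + 2 by ring]
  -- The zeta weights 2k and 2(N+1-k) add up to 2(N+1), so one common power of π comes out of every
  -- term.
  have hL : ∑ k ∈ Finset.Icc 1 N, (-β : ℂ) ^ k * (α : ℂ) ^ (N + 1 - k) *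
            riemannZeta (2 * k) * riemannZeta (2 * N + 2 - 2 * k)
      = (Real.pi : ℂ) ^ (2 * (N + 1)) *
        ∑ k ∈ Finset.Icc 1 N, (-1 : ℂ) ^ k * (α : ℂ) ^ (N - k + 1) * (β : ℂ) ^ k *
            besselZeta (1 / 2) k * besselZeta (1 / 2) ((N : ℂ) + 1 - k) := by
    rw [Finset.mul_sum]
    refine Finset.sum_congr rfl fun k hk => ?_
    obtain ⟨hk1, hk2⟩ := Finset.mem_Icc.mp hk
    have e := besselZeta_half (k := N + 1 - k) (by omega)
    rw [Nat.cast_sub (by omega)] at e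
    push_cast at e
    rw [besselZeta_half hk1, e, show (2 * ((N : ℂ) + 1 - k)) = 2 * N + 2 - 2 * k by ring,
      neg_pow (β : ℂ), show N + 1 - k = N - k + 1 by omega,
      show 2 * (N + 1) = 2 * k + 2 * (N - k + 1) by omega, pow_add (Real.pi : ℂ)]
    field_simp
  rw [hL, h, hz, pow_succ _ (2 * N), show 2 * (N + 1) = 2 * N + 1 + 1 by ring, pow_succ _ (2 * N + 1),
    pow_succ _ (2 * N)]
  push_cast
  field_simp

lemma besselZeta_convolution_tanRoot :
    ∑ k ∈ Finset.Icc 1 N, (-1 : ℂ) ^ (k - 1) * (α : ℂ) ^ (N - k + 1) * (β : ℂ) ^ k *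
            besselZeta (3 / 2) k * besselZeta (3 / 2) ((N : ℂ) + 1 - k)
          = -(3 / 2) * besselZeta (3 / 2) ((N : ℂ) + 1) *
              ((α : ℂ) ^ (N + 1) + (-β : ℂ) ^ (N + 1))
            + (α : ℂ) ^ N * β / 2 *
              ∑' n : ℕ, 1 / (tanRoot (n + 1) : ℂ) ^ (2 * N) *
                (1 / (√(β / α) * tanRoot (n + 1) * cothC (√(β / α) * tanRoot (n + 1)) - 1))
            + (-1 : ℂ) ^ (N + 1) * (β : ℂ) ^ N * α / 2 *
              ∑' n : ℕ, 1 / (tanRoot (n + 1) : ℂ) ^ (2 * N) *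
                (1 / (√(α / β) * tanRoot (n + 1) * cothC (√(α / β) * tanRoot (n + 1)) - 1)) := by
  have h := besselZeta_convolution (ν := 3 / 2) (by norm_num) hα hβ hN
  rw [(hasSum_tanRoot hα hβ hN).tsum_eq, (hasSum_tanRoot hβ hα hN).tsum_eq]
  generalize (∑' q : ℕ, 1 / (besselJZero (3 / 2) (q + 1) : ℂ) ^ (2 * N + 1) *
    (besselI (((3 / 2 : ℝ) : ℂ) - 1) (√(β / α) * besselJZero (3 / 2) (q + 1)) /
      besselI ((3 / 2 : ℝ) : ℂ) (√(β / α) * besselJZero (3 / 2) (q + 1)))) = S1 at *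
  generalize (∑' q : ℕ, 1 / (besselJZero (3 / 2) (q + 1) : ℂ) ^ (2 * N + 1) *
    (besselI (((3 / 2 : ℝ) : ℂ) - 1) (√(α / β) * besselJZero (3 / 2) (q + 1)) /
      besselI ((3 / 2 : ℝ) : ℂ) (√(α / β) * besselJZero (3 / 2) (q + 1)))) = S2 at *
  have hr1 : ((√(β / α) : ℝ) : ℂ) ≠ 0 := by
    exact_mod_cast (Real.sqrt_pos.mpr (by positivity : 0 < β / α)).ne'
  have hr2 : ((√(α / β) : ℝ) : ℂ) ≠ 0 := by
    exact_mod_cast (Real.sqrt_pos.mpr (by positivity : 0 < α / β)).ne'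
  have e1 : ((√(β / α) : ℝ) : ℂ) ^ 2 * α = β := by
    have : √(β / α) ^ 2 * α = β := by rw [Real.sq_sqrt (by positivity)]; field_simp
    exact_mod_cast this
  have e2 : ((√(α / β) : ℝ) : ℂ) ^ 2 * β = α := by
    have : √(α / β) ^ 2 * β = α := by rw [Real.sq_sqrt (by positivity)]; field_simp
    exact_mod_cast this
  have hL : ∑ k ∈ Finset.Icc 1 N, (-1 : ℂ) ^ (k - 1) * (α : ℂ) ^ (N - k + 1) * (β : ℂ) ^ k *
            besselZeta (3 / 2) k * besselZeta (3 / 2) ((N : ℂ) + 1 - k)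
      = -∑ k ∈ Finset.Icc 1 N, (-1 : ℂ) ^ k * (α : ℂ) ^ (N - k + 1) * (β : ℂ) ^ k *
            besselZeta (3 / 2) k * besselZeta (3 / 2) ((N : ℂ) + 1 - k) := by
    rw [← Finset.sum_neg_distrib]
    refine Finset.sum_congr rfl fun k hk => ?_
    obtain ⟨k, rfl⟩ := Nat.exists_eq_add_of_le' (Finset.mem_Icc.mp hk).1
    rw [Nat.add_sub_cancel, pow_succ (-1 : ℂ)]
    ring
  -- The prefactors agree because β/r₁ = α r₁, and symmetrically for r₂.
  have f1 : (α : ℂ) ^ N * β * (1 / ((√(β / α) : ℝ) : ℂ) * S1)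
      = (α : ℂ) ^ (N + 1) * ((√(β / α) : ℝ) : ℂ) * S1 := by
    rw [← e1]; field_simp; ring
  have f2 : (β : ℂ) ^ N * α * (1 / ((√(α / β) : ℝ) : ℂ) * S2)
      = (β : ℂ) ^ (N + 1) * ((√(α / β) : ℝ) : ℂ) * S2 := by
    rw [← e2]; field_simp; ring
  rw [hL, h, neg_pow (β : ℂ)]
  push_cast
  linear_combination (-1 / 2) * f1 - (-1) ^ (N + 1) / 2 * f2

lemma zeta_convolution_tanh :
    ∑ k ∈ Finset.Icc 1 N, (-1 : ℂ) ^ k * (α : ℂ) ^ (N - k + 1) * (β : ℂ) ^ k *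
            ((2 ^ (2 * k) - 1) * riemannZeta (2 * k)) *
            ((2 ^ (2 * N + 2 - 2 * k) - 1) * riemannZeta (2 * N + 2 - 2 * k))
          = - ((α : ℂ) ^ (N + 1) / 2 * Real.pi * √(β / α) *
              ∑' q : ℕ, 2 ^ (2 * N + 1) * (1 / (2 * (q : ℂ) + 1) ^ (2 * N + 1) *
                Complex.tanh (Real.pi / 2 * √(β / α) * (2 * (q : ℂ) + 1))))
            - (-β : ℂ) ^ (N + 1) / 2 * Real.pi * √(α / β) *
              ∑' q : ℕ, 2 ^ (2 * N + 1) * (1 / (2 * (q : ℂ) + 1) ^ (2 * N + 1) *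
                Complex.tanh (Real.pi / 2 * √(α / β) * (2 * (q : ℂ) + 1))) := by
  have hpi : (Real.pi : ℂ) ≠ 0 := by exact_mod_cast Real.pi_ne_zero
  have h := besselZeta_convolution (ν := -1 / 2) (by norm_num) hα hβ hN
  rw [tsum_mul_left, tsum_mul_left, (hasSum_tanh hα hβ hN).tsum_eq, (hasSum_tanh hβ hα hN).tsum_eq]
  generalize (∑' q : ℕ, 1 / (besselJZero (-1 / 2) (q + 1) : ℂ) ^ (2 * N + 1) *
    (besselI (((-1 / 2 : ℝ) : ℂ) - 1) (√(β / α) * besselJZero (-1 / 2) (q + 1)) /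
      besselI ((-1 / 2 : ℝ) : ℂ) (√(β / α) * besselJZero (-1 / 2) (q + 1)))) = S1 at *
  generalize (∑' q : ℕ, 1 / (besselJZero (-1 / 2) (q + 1) : ℂ) ^ (2 * N + 1) *
    (besselI (((-1 / 2 : ℝ) : ℂ) - 1) (√(α / β) * besselJZero (-1 / 2) (q + 1)) /
      besselI ((-1 / 2 : ℝ) : ℂ) (√(α / β) * besselJZero (-1 / 2) (q + 1)))) = S2 at *
  have hr1 : ((√(β / α) : ℝ) : ℂ) ≠ 0 := by
    exact_mod_cast (Real.sqrt_pos.mpr (by positivity : 0 < β / α)).ne'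
  have hr2 : ((√(α / β) : ℝ) : ℂ) ≠ 0 := by
    exact_mod_cast (Real.sqrt_pos.mpr (by positivity : 0 < α / β)).ne'
  have hL : ∑ k ∈ Finset.Icc 1 N, (-1 : ℂ) ^ k * (α : ℂ) ^ (N - k + 1) * (β : ℂ) ^ k *
            ((2 ^ (2 * k) - 1) * riemannZeta (2 * k)) *
            ((2 ^ (2 * N + 2 - 2 * k) - 1) * riemannZeta (2 * N + 2 - 2 * k))
      = (Real.pi : ℂ) ^ (2 * (N + 1)) *
        ∑ k ∈ Finset.Icc 1 N, (-1 : ℂ) ^ k * (α : ℂ) ^ (N - k + 1) * (β : ℂ) ^ k *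
            besselZeta (-1 / 2) k * besselZeta (-1 / 2) ((N : ℂ) + 1 - k) := by
    rw [Finset.mul_sum]
    refine Finset.sum_congr rfl fun k hk => ?_
    obtain ⟨hk1, hk2⟩ := Finset.mem_Icc.mp hk
    have e := besselZeta_neg_half (k := N + 1 - k) (by omega)
    rw [Nat.cast_sub (by omega)] at e
    push_cast at e
    rw [besselZeta_neg_half hk1, e, show (2 * ((N : ℂ) + 1 - k)) = 2 * N + 2 - 2 * k by ring,
      show 2 * N + 2 - 2 * k = 2 * (N - k + 1) by omega,
      show N + 1 - k = N - k + 1 by omega,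
      show 2 * (N + 1) = 2 * k + 2 * (N - k + 1) by omega, pow_add (Real.pi : ℂ)]
    field_simp
  rw [hL, h, div_pow]
  push_cast
  have h2 : (2 : ℂ) ^ (2 * N + 1) ≠ 0 := pow_ne_zero _ two_ne_zero
  generalize besselZeta (-1 / 2) ((N : ℂ) + 1) = Z
  -- The Z released by tanh z = quotient + 1/z is exactly the term with coefficient ν = -1/2 in the
  -- general identity, which is why no zeta value remains on the right.
  have f1 : (α : ℂ) ^ (N + 1) / 2 * Real.pi * √(β / α) * (2 ^ (2 * N + 1) *
      ((Real.pi : ℂ) ^ (2 * N + 1) / 2 ^ (2 * N + 1) * (S1 + 1 / (√(β / α) : ℂ) * Z)))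
      = (α : ℂ) ^ (N + 1) / 2 * (Real.pi : ℂ) ^ (2 * (N + 1)) * (√(β / α) * S1 + Z) := by
    rw [show 2 * (N + 1) = 2 * N + 1 + 1 by ring, pow_succ _ (2 * N + 1)]
    field_simp
  have f2 : (-β : ℂ) ^ (N + 1) / 2 * Real.pi * √(α / β) * (2 ^ (2 * N + 1) *
      ((Real.pi : ℂ) ^ (2 * N + 1) / 2 ^ (2 * N + 1) * (S2 + 1 / (√(α / β) : ℂ) * Z)))
      = (-β : ℂ) ^ (N + 1) / 2 * (Real.pi : ℂ) ^ (2 * (N + 1)) * (√(α / β) * S2 + Z) := by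
    rw [show 2 * (N + 1) = 2 * N + 1 + 1 by ring, pow_succ _ (2 * N + 1)]
    field_simp
  rw [f1, f2]
  ring

end special

end

theorem theorem3p7 :
    -- the convolution identity, with the convergence of all series in it
    (∀ ν : ℝ, -1 < ν →
      (StrictMono (besselJZero ν) ∧
        ∀ x : ℝ, 0 < x → (besselJ ν x = 0 ↔ ∃ n : ℕ, 1 ≤ n ∧ x = besselJZero ν n)) ∧
      (∀ k : ℕ, 1 ≤ k →
        Summable fun n : ℕ => 1 / (besselJZero ν (n + 1) : ℂ) ^ (2 * (k : ℂ))) ∧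
      ∀ α β : ℝ, 0 < α → 0 < β → ∀ N : ℕ, 1 ≤ N →
        (Summable fun q : ℕ => 1 / (besselJZero ν (q + 1) : ℂ) ^ (2 * N + 1) *
          (besselI (ν - 1) (√(β / α) * besselJZero ν (q + 1)) /
            besselI ν (√(β / α) * besselJZero ν (q + 1)))) ∧
        (Summable fun q : ℕ => 1 / (besselJZero ν (q + 1) : ℂ) ^ (2 * N + 1) *
          (besselI (ν - 1) (√(α / β) * besselJZero ν (q + 1)) /
            besselI ν (√(α / β) * besselJZero ν (q + 1)))) ∧
        ∑ k ∈ Finset.Icc 1 N, (-1 : ℂ) ^ k * (α : ℂ) ^ (N - k + 1) * (β : ℂ) ^ k *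
            besselZeta ν k * besselZeta ν ((N : ℂ) + 1 - k)
          = (ν : ℂ) * ((α : ℂ) ^ (N + 1) + (-β : ℂ) ^ (N + 1)) * besselZeta ν ((N : ℂ) + 1)
            - (α : ℂ) ^ (N + 1) / 2 * √(β / α) *
              ∑' q : ℕ, 1 / (besselJZero ν (q + 1) : ℂ) ^ (2 * N + 1) *
                (besselI (ν - 1) (√(β / α) * besselJZero ν (q + 1)) /
                  besselI ν (√(β / α) * besselJZero ν (q + 1)))
            - (-β : ℂ) ^ (N + 1) / 2 * √(α / β) *
              ∑' q : ℕ, 1 / (besselJZero ν (q + 1) : ℂ) ^ (2 * N + 1) *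
                (besselI (ν - 1) (√(α / β) * besselJZero ν (q + 1)) /
                  besselI ν (√(α / β) * besselJZero ν (q + 1)))) ∧
    -- the case `ν = 1/2`
    ((∀ n : ℕ, 1 ≤ n → besselJZero (1 / 2) n = n * Real.pi) ∧
      (∀ z : ℂ, z ≠ 0 → normalizedBesselJ (1 / 2) z = Complex.sin z / z) ∧
      (∀ z : ℂ, Complex.sinh z ≠ 0 → besselI (-1 / 2) z / besselI (1 / 2) z = cothC z) ∧
      ∀ α β : ℝ, 0 < α → 0 < β → ∀ N : ℕ, 1 ≤ N →
        (Summable fun n : ℕ => 1 / ((n : ℂ) + 1) ^ (2 * N + 1) *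
          (√(β / α) * cothC (Real.pi * ((n : ℂ) + 1) * √(β / α)))) ∧
        (Summable fun n : ℕ => 1 / ((n : ℂ) + 1) ^ (2 * N + 1) *
          (√(α / β) * cothC (Real.pi * ((n : ℂ) + 1) * √(α / β)))) ∧
        ∑ k ∈ Finset.Icc 1 N, (-β : ℂ) ^ k * (α : ℂ) ^ (N + 1 - k) *
            riemannZeta (2 * k) * riemannZeta (2 * N + 2 - 2 * k)
          = ((α : ℂ) ^ (N + 1) + (-β : ℂ) ^ (N + 1)) / 2 * riemannZeta (2 * N + 2)
            - (α : ℂ) ^ (N + 1) * Real.pi / 2 *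
              ∑' n : ℕ, 1 / ((n : ℂ) + 1) ^ (2 * N + 1) *
                (√(β / α) * cothC (Real.pi * ((n : ℂ) + 1) * √(β / α)))
            - Real.pi * (-β : ℂ) ^ (N + 1) / 2 *
              ∑' n : ℕ, 1 / ((n : ℂ) + 1) ^ (2 * N + 1) *
                (√(α / β) * cothC (Real.pi * ((n : ℂ) + 1) * √(α / β)))) ∧
    -- the case `ν = 3/2`
    ((∀ n : ℕ, besselJZero (3 / 2) n = tanRoot n) ∧
      (∀ z : ℂ, Complex.sinh z ≠ 0 → z * cothC z - 1 ≠ 0 →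
        besselI (1 / 2) z / besselI (3 / 2) z = z / (z * cothC z - 1)) ∧
      ∀ α β : ℝ, 0 < α → 0 < β → ∀ N : ℕ, 1 ≤ N →
        (Summable fun n : ℕ => 1 / (tanRoot (n + 1) : ℂ) ^ (2 * N) *
          (1 / (√(β / α) * tanRoot (n + 1) * cothC (√(β / α) * tanRoot (n + 1)) - 1))) ∧
        (Summable fun n : ℕ => 1 / (tanRoot (n + 1) : ℂ) ^ (2 * N) *
          (1 / (√(α / β) * tanRoot (n + 1) * cothC (√(α / β) * tanRoot (n + 1)) - 1))) ∧
        ∑ k ∈ Finset.Icc 1 N, (-1 : ℂ) ^ (k - 1) * (α : ℂ) ^ (N - k + 1) * (β : ℂ) ^ k *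
            besselZeta (3 / 2) k * besselZeta (3 / 2) ((N : ℂ) + 1 - k)
          = -(3 / 2) * besselZeta (3 / 2) ((N : ℂ) + 1) *
              ((α : ℂ) ^ (N + 1) + (-β : ℂ) ^ (N + 1))
            + (α : ℂ) ^ N * β / 2 *
              ∑' n : ℕ, 1 / (tanRoot (n + 1) : ℂ) ^ (2 * N) *
                (1 / (√(β / α) * tanRoot (n + 1) * cothC (√(β / α) * tanRoot (n + 1)) - 1))
            + (-1 : ℂ) ^ (N + 1) * (β : ℂ) ^ N * α / 2 *
              ∑' n : ℕ, 1 / (tanRoot (n + 1) : ℂ) ^ (2 * N) *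
                (1 / (√(α / β) * tanRoot (n + 1) * cothC (√(α / β) * tanRoot (n + 1)) - 1))) ∧
    -- the case `ν = -1/2`
    ((∀ z : ℂ, z ≠ 0 →
        besselJ (-1 / 2) z = √(2 / Real.pi) * Complex.cos z / z ^ (1 / 2 : ℂ)) ∧
      (∀ n : ℕ, 1 ≤ n → besselJZero (-1 / 2) n = Real.pi / 2 * (2 * n - 1)) ∧
      (∀ k : ℕ, 1 ≤ k → besselZeta (-1 / 2) k
        = (2 ^ (2 * k) - 1) / (Real.pi : ℂ) ^ (2 * k) * riemannZeta (2 * k)) ∧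
      (∀ z : ℂ, z ≠ 0 → Complex.cosh z ≠ 0 →
        besselI (-3 / 2) z / besselI (-1 / 2) z = Complex.tanh z - 1 / z) ∧
      ∀ α β : ℝ, 0 < α → 0 < β → ∀ N : ℕ, 1 ≤ N →
        (Summable fun q : ℕ => 1 / (2 * (q : ℂ) + 1) ^ (2 * N + 1) *
          Complex.tanh (Real.pi / 2 * √(β / α) * (2 * (q : ℂ) + 1))) ∧
        (Summable fun q : ℕ => 1 / (2 * (q : ℂ) + 1) ^ (2 * N + 1) *
          Complex.tanh (Real.pi / 2 * √(α / β) * (2 * (q : ℂ) + 1))) ∧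
        ∑ k ∈ Finset.Icc 1 N, (-1 : ℂ) ^ k * (α : ℂ) ^ (N - k + 1) * (β : ℂ) ^ k *
            ((2 ^ (2 * k) - 1) * riemannZeta (2 * k)) *
            ((2 ^ (2 * N + 2 - 2 * k) - 1) * riemannZeta (2 * N + 2 - 2 * k))
          = - ((α : ℂ) ^ (N + 1) / 2 * Real.pi * √(β / α) *
              ∑' q : ℕ, 2 ^ (2 * N + 1) * (1 / (2 * (q : ℂ) + 1) ^ (2 * N + 1) *
                Complex.tanh (Real.pi / 2 * √(β / α) * (2 * (q : ℂ) + 1))))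
            - (-β : ℂ) ^ (N + 1) / 2 * Real.pi * √(α / β) *
              ∑' q : ℕ, 2 ^ (2 * N + 1) * (1 / (2 * (q : ℂ) + 1) ^ (2 * N + 1) *
                Complex.tanh (Real.pi / 2 * √(α / β) * (2 * (q : ℂ) + 1)))) := by
  refine ⟨fun ν hν => ⟨⟨strictMono_besselJZero hν, fun x hx => besselJ_eq_zero_iff_exists hν hx⟩,
      fun k hk => summable_besselZeta hν hk, fun α β hα hβ N hN =>
        ⟨(hasSum_besselI_series hν hα hβ hN).summable, (hasSum_besselI_series hν hβ hα hN).summable,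
          besselZeta_convolution hν hα hβ hN⟩⟩,
    ⟨fun n _ => besselJZero_half n, fun z hz => normalizedBesselJ_half hz,
      fun z hz => besselI_neg_half_div hz, fun α β hα hβ N hN =>
        ⟨(hasSum_coth hα hβ hN).summable, (hasSum_coth hβ hα hN).summable,
          zeta_convolution_coth hα hβ hN⟩⟩,
    ⟨besselJZero_three_halves, fun z hz _ => besselI_half_div hz, fun α β hα hβ N hN =>
        ⟨(hasSum_tanRoot hα hβ hN).summable, (hasSum_tanRoot hβ hα hN).summable,
          besselZeta_convolution_tanRoot hα hβ hN⟩⟩,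
    ⟨fun z hz => besselJ_neg_half hz, fun n hn => ?_, fun k hk => besselZeta_neg_half hk,
      fun z hz hc => besselI_neg_three_halves_div hz hc, fun α β hα hβ N hN =>
        ⟨(hasSum_tanh hα hβ hN).summable, (hasSum_tanh hβ hα hN).summable,
          zeta_convolution_tanh hα hβ hN⟩⟩⟩
  obtain ⟨n, rfl⟩ := Nat.exists_eq_add_of_le' hn
  rw [besselJZero_neg_half_succ]
  push_cast
  ring
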